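/- **Protocol.** There are $n$ nodes, $qn$ of them adversarial and $(1-q)n\ge 1$ honest. Parameters: $k$ (number of responses collected by a node in a round), $m_0\ge 1$ (cooling-off period), $\ell\ge 1$, $1/2<a\le b<1$ and $\beta<1/2$, with $0\le q<\beta$. Each honest node starts with an opinion in $\{0,1\}$. In round $m=1,2,\dots$ each honest node independently queries uniformly chosen nodes (with repetition, self-queries allowed) until it has $k$ responses; let $\eta_m(j)$ be the number of $1$'s among those received by node $j$. Then one common threshold $X_m$ is released, with $X_1\in[a,b]$ and $X_m\in[\beta,1-\beta]$ for $m\ge2$, and each honest node without final opinion adopts opinion $1$ if $k^{-1}\eta_m(j)\ge X_m$ and opinion $0$ otherwise. An opinion held during $\ell$ consecutive rounds, counting from round $m_0+1$ on, becomes final. Honest nodes answer all queries with their current opinion. The adversary is omniscient (but cannot foresee the queries of a round before they are made). He is *cautious* if in each round he fixes an opinion for each of his nodes before the queries of the round are made and each of his nodes answers all queries with it; *semi-cautious* if the same holds except that his nodes may leave any queries unanswered; *berserk* if his nodes may answer each query arbitrarily or not at all. **Random numbers.** Let $\theta\in(0,1)$. In each round $m$ there is an event $G_m$, possibly known to the adversary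 before the queries of round $m$ are made, which has conditional probability at least $\theta$ given everything that happened up to round $m-1$; on $G_m$ the threshold $X_m$ is uniform on its interval ($[a,b]$ if $m=1$, $[\beta,1-\beta]$ if $m\geq 2$) and independent of everything that precedes its release, including the queries and answers of round $m$. Outside $G_m$, $X_m$ is arbitrary in its interval (it may be chosen by the adversary). Every honest node sees the same $X_m$. **Notation.** Put $\varepsilon=e^{-\frac12k(\beta-q)^2}$ and assume that $\varphi=\frac{\beta-q}{2(1-q)}-\varepsilon>0$. For an integer $u\ge0$ let $$W=(1-q)n\Big(\big(1-(1-\varepsilon)^\ell\big)^u+\Big(\frac{\varepsilon}{1-\varepsilon}\Big)^{\ell-1}\Big)+(m_0+\ell u)\,e^{-2(1-q)n\varphi^2},$$ and let $t=2\exp\big(-\tfrac18n\tfrac{(\beta-q)^2}{4(1-q)}\big)$, $r=\sqrt{2k^{-1}\ln\tfrac{4(1-q)}{\beta-q}}$, $$\psi_{cau}=t+\frac{r}{1-2\beta},\qquad \psi_{ber}=t+\frac{q+r}{1-2\beta},\qquad \psi_{semi}=t+\frac{\frac1{2-q}-\beta+r}{1-2\beta}.$$ Let $H_i$ be the event that all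 honest nodes eventually reach final opinion $i$, and $\mathcal N$ the number of rounds until all honest nodes have final opinions. **Proposition.** For $*=cau$ and any strategy of a cautious adversary, for $*=ber$ and any strategy of a berserk adversary, and, if $\frac1{2-q}-\beta+r<1-2\beta$, for $*=semi$ and any strategy of a semi-cautious adversary, $$\mathbb P\big[(H_0\cup H_1)\cap\{\mathcal N\le m_0+\ell u\}\big]\ \ge\ 1-W-\big(1-\theta+\theta\psi_*\big)^{m_0-1}.$$ -/

import Mathlib

open MeasureTheory ProbabilityTheory
open scoped ENNReal

noncomputable section

namespace FPC

/-- Parameters of the consensus protocol: numbers of honest and of adversarial nodes, number `k` of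
responses collected per round, cooling-off period `m₀`, length `ℓ` of a finalizing run, limits
`a, b` of the first threshold and limit `β` of the later ones. -/
structure Params where
  honest : ℕ
  adversarial : ℕ
  k : ℕ
  m₀ : ℕ
  ℓ : ℕ
  a : ℝ
  b : ℝ
  β : ℝ

namespace Params

variable (p : Params)

/-- The total number of nodes. -/
def n : ℕ := p.honest + p.adversarial

/-- The proportion of adversarial nodes, so that there are `(1 - q) n` honest ones. -/
def q : ℝ := (p.adversarial : ℝ) / (p.n : ℝ)

/-- A node is either honest or adversarial. -/
abbrev Node : Type := Fin p.honest ⊕ Fin p.adversarial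

/-- Lower limit of the decision threshold of round `m`. -/
def lower (m : ℕ) : ℝ := if m = 1 then p.a else p.β

/-- Upper limit of the decision threshold of round `m`. -/
def upper (m : ℕ) : ℝ := if m = 1 then p.b else 1 - p.β

/-- `exp (-k (β - q)² / 2)`. -/
def ε : ℝ := Real.exp (-(1 / 2) * p.k * (p.β - p.q) ^ 2)

/-- The quantity `φ_{β,q,k}`. -/
def φ : ℝ := (p.β - p.q) / (2 * (1 - p.q)) - p.ε

/-- The quantity `W(n, k, m₀, ℓ, u)`. -/
def W (u : ℕ) : ℝ :=
  (1 - p.q) * p.n * ((1 - (1 - p.ε) ^ p.ℓ) ^ u + (p.ε / (1 - p.ε)) ^ (p.ℓ - 1))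
    + (p.m₀ + p.ℓ * u : ℝ) * Real.exp (-2 * (1 - p.q) * p.n * p.φ ^ 2)

/-- `√(2 k⁻¹ ln (4 (1 - q) / (β - q)))`. -/
def fringe : ℝ := Real.sqrt (2 * (p.k : ℝ)⁻¹ * Real.log (4 * (1 - p.q) / (p.β - p.q)))

/-- `2 exp (-(1/8) n (β - q)² / (4 (1 - q)))`. -/
def tail : ℝ :=
  2 * Real.exp (-(1 / 8) * p.n * ((p.β - p.q) ^ 2 / (4 * (1 - p.q))))

def ψCau : ℝ := p.tail + (1 - 2 * p.β)⁻¹ * p.fringe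

def ψBer : ℝ := p.tail + (p.q + p.fringe) / (1 - 2 * p.β)

def ψSemi : ℝ := p.tail + (1 / (2 - p.q) - p.β + p.fringe) / (1 - 2 * p.β)

end Params

/-- The uniform distribution on `[lo, hi]` (the point mass if `lo = hi`). -/
def unifLaw (lo hi : ℝ) : Measure ℝ :=
  (volume.restrict (Set.Icc (0 : ℝ) 1)).map (fun t => lo + t * (hi - lo))

/-- The number of answers `1` among the first `k` answers received, when the `i`-th query issued
is answered by `ans i` (`none` if it remains unanswered). -/
def ones (k : ℕ) (ans : ℕ → Option Bool) : ℕ :=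
  {i : ℕ | ans i = some true ∧
    ((Finset.range i).filter (fun i' => ans i' ≠ none)).card < k}.ncard

/-- The local state of an honest node: its opinion, and the number of consecutive rounds,
counted from round `m₀ + 1` on, in which it has had that opinion. -/
structure NodeState where
  opinion : Bool
  streak : ℕ

/-- The update in round `m` of the state of an honest node for which the comparison with the
threshold gives `v`. An opinion held for `ℓ` counted rounds is final and never changes. -/
def NodeState.step (p : Params) (m : ℕ) (s : NodeState) (v : Bool) : NodeState :=
  if p.ℓ ≤ s.streak then s
  else
    { opinion := v
      streak :=
        if m ≤ p.m₀ then 0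
        else if 0 < s.streak ∧ v = s.opinion then s.streak + 1
        else 1 }

/-- An execution of the protocol, on the probability space `(Ω, P)`, against an adversary of
unrestricted behaviour. Rounds are numbered `1, 2, …`.

* `past m` is all information existing after round `m` (after `0` rounds: initially);
* `pre m` is the information existing in round `m` before the honest nodes choose whom to query;
* `mid m` is the information existing in round `m` just before the threshold is released.

They contain everything the adversary knows at these moments, including random choices of his.
`query m j i` is the target of the `i`-th query of the honest node `j` in round `m`, and
`reply m ω v j i` is what the adversarial node `v` answers to that query if it is directed to
`v`. The event `good m`, that the random number of round `m` is sound, has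
conditional probability at least `θ` given the past; on it the threshold is uniform and
independent of all that precedes its release. Outside of `good m` the threshold is any random
variable with values in the prescribed interval. -/
structure Execution (p : Params) (θ : ℝ) {Ω : Type*} [mΩ : MeasurableSpace Ω]
    (P : Measure Ω) where
  past : ℕ → MeasurableSpace Ω
  pre : ℕ → MeasurableSpace Ω
  mid : ℕ → MeasurableSpace Ω
  past_le_pre : ∀ m, past m ≤ pre (m + 1)
  pre_le_mid : ∀ m, pre (m + 1) ≤ mid (m + 1)
  mid_le_past : ∀ m, mid (m + 1) ≤ past (m + 1)
  past_le : ∀ m, past m ≤ mΩ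
  /-- initial opinions of the honest nodes -/
  init : Ω → Fin p.honest → Bool
  init_meas : ∀ j, MeasurableSet[past 0] {ω | init ω j = true}
  query : ℕ → Fin p.honest → ℕ → Ω → p.Node
  query_meas : ∀ m j i t, MeasurableSet[mid (m + 1)] {ω | query (m + 1) j i ω = t}
  query_unif : ∀ m j i t, P {ω | query (m + 1) j i ω = t} = (p.n : ℝ≥0∞)⁻¹
  query_iIndep : ∀ m, iIndepFun (fun x : Fin p.honest × ℕ => query (m + 1) x.1 x.2) P
  query_indep : ∀ m,
    Indep (⨆ x : Fin p.honest × ℕ, MeasurableSpace.comap (query (m + 1) x.1 x.2) ⊤)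
      (pre (m + 1)) P
  reply : ℕ → Ω → Fin p.adversarial → Fin p.honest → ℕ → Option Bool
  reply_meas : ∀ m v j i r, MeasurableSet[mid (m + 1)] {ω | reply (m + 1) ω v j i = r}
  good : ℕ → Set Ω
  good_meas : ∀ m, MeasurableSet[pre (m + 1)] (good (m + 1))
  good_prob : ∀ m A, MeasurableSet[past m] A → θ * P.real A ≤ P.real (A ∩ good (m + 1))
  threshold : ℕ → Ω → ℝ
  threshold_meas : ∀ m, Measurable[past (m + 1)] (threshold (m + 1))
  threshold_mem : ∀ m ω,
    threshold (m + 1) ω ∈ Set.Icc (p.lower (m + 1)) (p.upper (m + 1))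
  threshold_unif : ∀ m A S, MeasurableSet[mid (m + 1)] A → MeasurableSet S →
    P (A ∩ good (m + 1) ∩ threshold (m + 1) ⁻¹' S) =
      P (A ∩ good (m + 1)) * unifLaw (p.lower (m + 1)) (p.upper (m + 1)) S

namespace Execution

variable {p : Params} {θ : ℝ} {Ω : Type*} [MeasurableSpace Ω] {P : Measure Ω}

/-- The answer to the `i`-th query of the honest node `j` in round `m`, if the honest nodes
hold the opinions `ξ`. Honest nodes always answer, with their opinion. -/
def answer (E : Execution p θ P) (ω : Ω) (m : ℕ) (ξ : Fin p.honest → Bool)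
    (j : Fin p.honest) (i : ℕ) : Option Bool :=
  match E.query m j i ω with
  | Sum.inl j' => some (ξ j')
  | Sum.inr v => E.reply m ω v j i

open Classical in
/-- The state of the honest node `j` after round `m`. -/
def state (E : Execution p θ P) (ω : Ω) : ℕ → Fin p.honest → NodeState
  | 0 => fun j => ⟨E.init ω j, 0⟩
  | m + 1 => fun j =>
      (E.state ω m j).step p (m + 1)
        (decide (E.threshold (m + 1) ω ≤
          (p.k : ℝ)⁻¹ * (ones p.k (E.answer ω (m + 1) (fun j' => (E.state ω m j').opinion) j) : ℝ)))

/-- The honest node `j` has a final opinion after round `m`. -/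
def IsFinal (E : Execution p θ P) (ω : Ω) (m : ℕ) (j : Fin p.honest) : Prop :=
  p.ℓ ≤ (E.state ω m j).streak

/-- The event that all honest nodes eventually reach the final opinion `c`. -/
def allFinal (E : Execution p θ P) (c : Bool) : Set Ω :=
  {ω | ∀ j, ∃ m, E.IsFinal ω m j ∧ (E.state ω m j).opinion = c}

/-- The number of rounds until all honest nodes have final opinions (`⊤` if this never
happens). -/
def numRounds (E : Execution p θ P) (ω : Ω) : ℕ∞ :=
  sInf ((fun m : ℕ => (m : ℕ∞)) '' {m : ℕ | ∀ j, E.IsFinal ω m j})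

/-- Cautious adversary: in each round, opinions of his nodes are chosen before the queries are
made, and are reported to whoever asks. -/
def IsCautious (E : Execution p θ P) : Prop :=
  ∃ bit : ℕ → Ω → Fin p.adversarial → Bool,
    (∀ m v, MeasurableSet[E.pre (m + 1)] {ω | bit (m + 1) ω v = true}) ∧
    ∀ m ω v j i, E.reply (m + 1) ω v j i = some (bit (m + 1) ω v)

/-- Semi-cautious adversary: as a cautious one, but his nodes may leave any of the queries
unanswered. -/
def IsSemiCautious (E : Execution p θ P) : Prop :=
  ∃ bit : ℕ → Ω → Fin p.adversarial → Bool,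
    (∀ m v, MeasurableSet[E.pre (m + 1)] {ω | bit (m + 1) ω v = true}) ∧
    ∀ m ω v j i, E.reply (m + 1) ω v j i = none ∨
      E.reply (m + 1) ω v j i = some (bit (m + 1) ω v)

end Execution

end FPC

end

/-! The proof compares true samples with least favourable ones. Call an opinion prevailing in a
round if at most `p.minority` = n(β-q)/2 honest nodes decide against it, and call it a preconsensus
if at most that many hold the other opinion.

Persistence. Under a preconsensus for c, even if all adversarial nodes answer against c, a query
yields c with probability at least 1-β+(β-q)/2. No threshold in [β,1-β] can defeat c unless a sample
falls short of its mean by (β-q)/2. By Hoeffding's inequality a given node errs with conditional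
probability at most ε (`measure_decision_ne_le`). Since ε+φ is the share of the minority among the
honest nodes, Hoeffding's inequality for independent nodes bounds the probability that c fails to
prevail (`measure_not_prevails_le`).

Creation. Let x₁ and x₀ be the proportions of answers 1 and 0 in the samples least favourable to 1
and to 0. Apart from an event of probability `p.tail`, one opinion prevails unless the threshold
lies strictly between x₁-r/2 and 1-x₀+r/2 (`measure_no_prevails_le`). A sound random threshold hits
this interval with probability at most D, which depends on the class of the adversary. So all of the
rounds 2, …, m₀ fail with probability at most (1-θ+θ(t+D))^(m₀-1).

Finalization. From round m₀ on, each node faces trials in which an error has conditional probability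
at most ε. A run of ℓ correct decisions fails to occur first, within u blocks of length ℓ, with
probability at most (1-(1-ε)^ℓ)^u + (ε/(1-ε))^(ℓ-1) (`measure_not_final_false_le`). If this run is
reached by every node and no majority is lost, all nodes finalize the same opinion
(`final_of_consolidated`). A union bound over nodes and rounds gives W (`consensus_of_prevails`).

The adversary's replies may depend on the queries of the round, so Hoeffding's inequality is not
applied to the actual answers. It is applied to answers by a fixed function of the target, which the
actual ones dominate (`Constrained.dominated`); opinions and preferences are frozen by splitting
into fibres. -/

noncomputable section

namespace FPC

/-! ### Counting the first `k` responses -/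

/-- The number of the first `T` queries that are answered. -/
def responses (ans : ℕ → Option Bool) (T : ℕ) : ℕ :=
  ((Finset.range T).filter (fun i => ans i ≠ none)).card

/-- The number of answers `c` to the first `T` queries that are among the first `k` responses. -/
def tally (k : ℕ) (ans : ℕ → Option Bool) (c : Bool) (T : ℕ) : ℕ :=
  ((Finset.range T).filter (fun i => ans i = some c ∧ responses ans i < k)).card

theorem responses_succ (ans : ℕ → Option Bool) (T : ℕ) :
    responses ans (T + 1) = responses ans T + if ans T = none then 0 else 1 := by
  unfold responses
  rw [Finset.range_add_one, Finset.filter_insert]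
  by_cases h : ans T = none
  · simp [h]
  · rw [if_pos h, if_neg h, Finset.card_insert_of_notMem (by simp)]

theorem tally_succ (k : ℕ) (ans : ℕ → Option Bool) (c : Bool) (T : ℕ) :
    tally k ans c (T + 1) =
      tally k ans c T + if ans T = some c ∧ responses ans T < k then 1 else 0 := by
  unfold tally
  rw [Finset.range_add_one, Finset.filter_insert]
  split_ifs with h1
  · rw [Finset.card_insert_of_notMem (by simp)]
  · rfl

@[simp] theorem responses_zero (ans : ℕ → Option Bool) : responses ans 0 = 0 := rfl

@[simp] theorem tally_zero (k : ℕ) (ans : ℕ → Option Bool) (c : Bool) : tally k ans c 0 = 0 := rfl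

theorem responses_mono (ans : ℕ → Option Bool) : Monotone (responses ans) :=
  monotone_nat_of_le_succ fun T => by rw [responses_succ]; omega

theorem tally_mono (k : ℕ) (ans : ℕ → Option Bool) (c : Bool) : Monotone (tally k ans c) :=
  monotone_nat_of_le_succ fun T => by rw [tally_succ]; omega

theorem tally_add_tally (k : ℕ) (ans : ℕ → Option Bool) (T : ℕ) :
    tally k ans true T + tally k ans false T = min k (responses ans T) := by
  induction T with
  | zero => simp
  | succ T ih =>
    rw [tally_succ, tally_succ, responses_succ]
    rcases h : ans T with _ | _ | _ <;> simp <;> (try split_ifs) <;> omega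

theorem tally_congr {k : ℕ} {ans ans' : ℕ → Option Bool} {T : ℕ} (h : ∀ i < T, ans i = ans' i)
    (c : Bool) : responses ans T = responses ans' T ∧ tally k ans c T = tally k ans' c T := by
  induction T with
  | zero => simp
  | succ T ih =>
    obtain ⟨h1, h2⟩ := ih fun i hi => h i (hi.trans (Nat.lt_succ_self T))
    rw [responses_succ, tally_succ, responses_succ, tally_succ, h1, h2, h T (Nat.lt_succ_self T)]
    exact ⟨rfl, rfl⟩

/-- Once a tally has attained its limiting value, it is `ones`. -/
theorem exists_tally_eq_ones (k : ℕ) (ans : ℕ → Option Bool) :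
    ∃ T₀, ∀ T, T₀ ≤ T → tally k ans true T = ones k ans := by
  set S : Set ℕ := {i : ℕ | ans i = some true ∧ responses ans i < k} with hS
  have hfin : S.Finite := by
    -- On `S` the function `responses ans` is injective, since each member is itself answered, and
    -- its values are below `k`.
    refine Set.Finite.of_finite_image (f := responses ans)
      ((Set.finite_Iio k).subset ?_) ?_
    · rintro _ ⟨i, hi, rfl⟩
      exact hi.2
    · have key : ∀ i j, i ∈ S → i < j → responses ans i < responses ans j := by
        intro i j hi hij
        refine lt_of_lt_of_le ?_ (responses_mono ans (Nat.succ_le_of_lt hij))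
        rw [Nat.succ_eq_add_one, responses_succ, hi.1]
        simp
      intro i hi j hj hij
      rcases lt_trichotomy i j with h | h | h
      · exact absurd hij (key i j hi h).ne
      · exact h
      · exact absurd hij.symm (key j i hj h).ne
  obtain ⟨b, hb⟩ := hfin.bddAbove
  refine ⟨b + 1, fun T hT => ?_⟩
  have : (S : Set ℕ) =
      ↑((Finset.range T).filter (fun i => ans i = some true ∧ responses ans i < k)) := by
    ext i
    simp only [Finset.coe_filter, Finset.mem_range, Set.mem_ofPred_eq, hS]
    exact ⟨fun h => ⟨by have := hb h; omega, h⟩, fun h => h.2⟩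
  change _ = S.ncard
  rw [this, Set.ncard_coe_finset]
  rfl

theorem tally_le_ones (k : ℕ) (ans : ℕ → Option Bool) (T : ℕ) :
    tally k ans true T ≤ ones k ans := by
  obtain ⟨T₀, h⟩ := exists_tally_eq_ones k ans
  rw [← h _ (le_max_left T₀ T)]
  exact tally_mono k ans true (le_max_right T₀ T)

theorem ones_eq_tally_of_le_responses {k : ℕ} {ans : ℕ → Option Bool} {T : ℕ}
    (h : k ≤ responses ans T) : ones k ans = tally k ans true T := by
  obtain ⟨T₀, h₀⟩ := exists_tally_eq_ones k ans
  have h1 := tally_add_tally k ans T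
  have h2 := tally_add_tally k ans (max T₀ T)
  have h3 := tally_mono k ans true (le_max_right T₀ T)
  have h4 := tally_mono k ans false (le_max_right T₀ T)
  rw [← h₀ _ (le_max_left T₀ T)]
  omega

/-- Answers compared with the opinion `c`. -/
def agree (c : Bool) (ans : ℕ → Option Bool) : ℕ → Option Bool :=
  fun i => (ans i).map (fun v => v == c)

theorem agree_true (ans : ℕ → Option Bool) : agree true ans = ans := by
  funext i
  rcases h : ans i with _ | _ | _ <;> simp [agree, h]

theorem tally_agree_false (k : ℕ) (ans : ℕ → Option Bool) (c : Bool) (T : ℕ) :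
    responses (agree false ans) T = responses ans T ∧
      tally k (agree false ans) c T = tally k ans (!c) T := by
  induction T with
  | zero => simp
  | succ T ih =>
    rw [responses_succ, responses_succ, tally_succ, tally_succ, ih.1, ih.2]
    rcases h : ans T with _ | _ | _ <;> cases c <;> simp [agree, h]

/-- Only an inequality, as fewer than `k` responses may ever arrive. -/
theorem ones_add_ones_agree_false_le (k : ℕ) (ans : ℕ → Option Bool) :
    ones k ans + ones k (agree false ans) ≤ k := by
  obtain ⟨T₀, h₀⟩ := exists_tally_eq_ones k ans
  obtain ⟨T₁, h₁⟩ := exists_tally_eq_ones k (agree false ans)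
  rw [← h₀ _ (le_max_left T₀ T₁), ← h₁ _ (le_max_right T₀ T₁), (tally_agree_false _ _ _ _).2]
  have := tally_add_tally k ans (max T₀ T₁)
  simp only [Bool.not_true]
  omega

/-- The answers `ans'` are pointwise at most as favourable to the opinion `1` as `ans`. -/
def Dominated (ans' ans : ℕ → Option Bool) : Prop :=
  ∀ i, (ans' i = some true → ans i = some true) ∧ (ans i = some false → ans' i = some false)

/-- Changing a `0` to silence shifts which later responses are counted, so the samples cannot be
compared query by query. The induction therefore carries both tallies: if the sample of `ans` is
full while that of `ans'` is not, having no more `0`'s forces it to have more `1`'s, by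
`tally_add_tally`. -/
theorem Dominated.ones_le {ans' ans : ℕ → Option Bool} (h : Dominated ans' ans) (k : ℕ) :
    ones k ans' ≤ ones k ans := by
  have key : ∀ T, tally k ans' true T ≤ tally k ans true T ∧
      tally k ans false T ≤ tally k ans' false T := by
    intro T
    induction T with
    | zero => simp
    | succ T ih =>
      have e1 := tally_add_tally k ans T
      have e2 := tally_add_tally k ans' T
      obtain ⟨h1, h2⟩ := h T
      rw [tally_succ, tally_succ, tally_succ, tally_succ]
      rcases ha : ans T with _ | _ | _ <;> rcases ha' : ans' T with _ | _ | _ <;>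
        simp [ha, ha'] at h1 h2 ⊢ <;> (try split_ifs) <;> omega
  obtain ⟨T₀, h₀⟩ := exists_tally_eq_ones k ans'
  rw [← h₀ T₀ le_rfl]
  exact (key T₀).1.trans (tally_le_ones k ans T₀)

/-! ### Hoeffding's inequality for samples with unanswered queries -/

/-- Hoeffding's lemma for a centred Bernoulli variable. -/
theorem bernoulli_mgf_le {p : ℝ} (h0 : 0 ≤ p) (h1 : p ≤ 1) (t : ℝ) :
    p * Real.exp (t * (p - 1)) + (1 - p) * Real.exp (t * p) ≤ Real.exp (t ^ 2 / 8) := by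
  set μ : Measure ℝ := ENNReal.ofReal p • Measure.dirac 1 + ENNReal.ofReal (1 - p) • Measure.dirac 0
    with hμ
  have hint : ∀ g : ℝ → ℝ, Measurable g → ∫ x, g x ∂μ = p * g 1 + (1 - p) * g 0 := by
    intro g hg
    have hi : ∀ x : ℝ, Integrable g (Measure.dirac x) := fun x =>
      (integrable_dirac (by simp))
    rw [hμ, integral_add_measure ((hi 1).smul_measure ENNReal.ofReal_ne_top)
      ((hi 0).smul_measure ENNReal.ofReal_ne_top), integral_smul_measure, integral_smul_measure,
      integral_dirac, integral_dirac, ENNReal.toReal_ofReal h0, ENNReal.toReal_ofReal (by linarith)]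
    simp
  have : IsProbabilityMeasure μ := by
    constructor
    simp only [hμ, Measure.coe_add, Measure.coe_smul, Pi.add_apply, Pi.smul_apply, measure_univ,
      smul_eq_mul, mul_one]
    rw [← ENNReal.ofReal_add h0 (by linarith)]
    simp
  have hb : ∀ᵐ x ∂μ, id x ∈ Set.Icc (0 : ℝ) 1 := by
    rw [hμ, ae_add_measure_iff]
    exact ⟨Measure.ae_smul_measure (by simp [ae_dirac_eq]) _,
      Measure.ae_smul_measure (by simp [ae_dirac_eq]) _⟩
  have h := (hasSubgaussianMGF_of_mem_Icc (μ := μ) (X := id) measurable_id.aemeasurable hb).mgf_le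
    (-t)
  rw [hint id measurable_id] at h
  unfold mgf at h
  rw [hint _ (by fun_prop)] at h
  simp only [id] at h
  have e1 : -t * (1 - (p * 1 + (1 - p) * 0)) = t * (p - 1) := by ring
  have e2 : -t * (0 - (p * 1 + (1 - p) * 0)) = t * p := by ring
  have e3 : (((‖(1 : ℝ) - 0‖₊ / 2) ^ 2 : NNReal) : ℝ) * (-t) ^ 2 / 2 = t ^ 2 / 8 := by
    rw [sub_zero, nnnorm_one]
    push_cast
    ring
  rwa [e1, e2, e3] at h

section Sampling

variable {Ω N : Type*}

variable (f : N → Option Bool)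

theorem exists_factor {Φ : (ℕ → Option Bool) → ℝ} {T : ℕ}
    (hΦ : ∀ a a', (∀ i < T, a i = a' i) → Φ a = Φ a') :
    ∃ G : (Finset.range T → N) → ℝ, ∀ x : ℕ → N,
      Φ (fun i => f (x i)) = G (fun i => x i) := by
  refine ⟨fun g => Φ (fun i => if h : i ∈ Finset.range T then f (g ⟨i, h⟩) else none), fun x => ?_⟩
  refine hΦ _ _ fun i hi => ?_
  rw [dif_pos (Finset.mem_range.2 hi)]

/-- The exponential supermartingale of the sampling of `k` responses. -/
def expTally (k : ℕ) (t p : ℝ) (T : ℕ) (a : ℕ → Option Bool) : ℝ :=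
  Real.exp (t * (p * (tally k a true T + tally k a false T) - tally k a true T)
    - t ^ 2 / 8 * (tally k a true T + tally k a false T))

/-- The factor by which one further answer changes `expTally`. -/
def stepWeight (t p : ℝ) : Option Bool → ℝ
  | none => 1
  | some true => Real.exp (t * (p - 1) - t ^ 2 / 8)
  | some false => Real.exp (t * p - t ^ 2 / 8)

theorem expTally_succ (k : ℕ) (t p : ℝ) (T : ℕ) (a : ℕ → Option Bool) :
    expTally k t p (T + 1) a = (if k ≤ responses a T then expTally k t p T a else 0) +
      (if k ≤ responses a T then 0 else expTally k t p T a) * stepWeight t p (a T) := by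
  unfold expTally
  rw [tally_succ, tally_succ]
  by_cases hk : k ≤ responses a T
  · simp [hk, not_lt.2 hk]
  · rw [if_neg hk, if_neg hk]
    rcases h : a T with _ | _ | _ <;> simp [stepWeight, not_le.1 hk, ← Real.exp_add] <;> ring

/-- The supermartingale property of one query: silent targets contribute the factor 1, and over the
responding targets, among which `1` has proportion `p`, the mean factor is at most 1 by Hoeffding's
lemma. -/
theorem sum_stepWeight_le [Fintype N] {p : ℝ} (h0 : 0 ≤ p) (h1 : p ≤ 1) (t : ℝ)
    (hp : ((Finset.univ.filter fun x => f x = some true).card : ℝ) =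
      p * (Finset.univ.filter fun x => f x ≠ none).card) :
    ∑ x, stepWeight t p (f x) ≤ Fintype.card N := by
  classical
  set y := (Finset.univ.filter fun x => f x = some true).card with hy
  set z := (Finset.univ.filter fun x => f x = some false).card with hz
  set r := (Finset.univ.filter fun x => f x ≠ none).card with hr
  set s := (Finset.univ.filter fun x => f x = none).card with hs
  have hyz : r = y + z := by
    rw [hr, hy, hz, ← Finset.card_union_of_disjoint]
    · congr 1
      ext x
      rcases h : f x with _ | _ | _ <;> simp [h]
    · rw [Finset.disjoint_filter]
      intro x _ hx
      simp [hx]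
  have hN : Fintype.card N = r + s := by
    rw [hr, hs, add_comm, Finset.card_filter_add_card_filter_not, Finset.card_univ]
  have hsum : ∑ x, stepWeight t p (f x) =
      y * Real.exp (t * (p - 1) - t ^ 2 / 8) + z * Real.exp (t * p - t ^ 2 / 8) + s := by
    rw [hy, hz, hs, Finset.card_filter, Finset.card_filter, Finset.card_filter]
    push_cast
    rw [Finset.sum_mul, Finset.sum_mul, ← Finset.sum_add_distrib, ← Finset.sum_add_distrib]
    refine Finset.sum_congr rfl fun x _ => ?_
    rcases h : f x with _ | _ | _ <;> simp [stepWeight]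
  have hyz' : (r : ℝ) = y + z := by exact_mod_cast hyz
  have hz' : (z : ℝ) = (1 - p) * r := by rw [hp] at hyz'; linarith
  have hb := bernoulli_mgf_le h0 h1 t
  have hb' : p * Real.exp (t * (p - 1) - t ^ 2 / 8) + (1 - p) * Real.exp (t * p - t ^ 2 / 8) ≤ 1 := by
    rw [Real.exp_sub, Real.exp_sub, ← mul_div_assoc, ← mul_div_assoc, ← add_div,
      div_le_one (Real.exp_pos _)]
    exact hb
  rw [hsum, hN, hz', hp]
  push_cast
  have : (r : ℝ) * (p * Real.exp (t * (p - 1) - t ^ 2 / 8) +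
      (1 - p) * Real.exp (t * p - t ^ 2 / 8)) ≤ r * 1 :=
    mul_le_mul_of_nonneg_left hb' (Nat.cast_nonneg _)
  linarith

variable [MeasurableSpace Ω] {P : Measure Ω} [Fintype N]
  [MeasurableSpace N] [MeasurableSingletonClass N] {X : ℕ → Ω → N}

theorem integral_comp_uniform [IsProbabilityMeasure P] {Y : Ω → N} (hY : Measurable Y)
    (hunif : ∀ t, P {ω | Y ω = t} = (Fintype.card N : ℝ≥0∞)⁻¹) (w : N → ℝ) :
    ∫ ω, w (Y ω) ∂P = (Fintype.card N : ℝ)⁻¹ * ∑ t, w t := by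
  rw [← integral_map hY.aemeasurable (measurable_of_finite w).aestronglyMeasurable,
    integral_fintype Integrable.of_finite, Finset.mul_sum]
  refine Finset.sum_congr rfl fun t _ => ?_
  have : (P.map Y).real {t} = (Fintype.card N : ℝ)⁻¹ := by
    rw [measureReal_def, Measure.map_apply hY (measurableSet_singleton t)]
    have := hunif t
    change P (Y ⁻¹' {t}) = _ at this
    rw [this]
    simp
  rw [this, smul_eq_mul]

theorem integrable_of_prefix [IsProbabilityMeasure P] (hX : ∀ i, Measurable (X i))
    {Φ : (ℕ → Option Bool) → ℝ} {T : ℕ}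
    (hΦ : ∀ a a', (∀ i < T, a i = a' i) → Φ a = Φ a') :
    Integrable (fun ω => Φ (fun i => f (X i ω))) P := by
  obtain ⟨G, hG⟩ := exists_factor f hΦ
  simp_rw [fun ω => hG (fun i => X i ω)]
  have hU : Measurable fun ω => fun i : Finset.range T => X i ω :=
    measurable_pi_lambda _ fun i => hX i
  exact (integrable_map_measure (measurable_of_finite G).aestronglyMeasurable
    hU.aemeasurable).1 Integrable.of_finite

theorem integral_prefix_mul [IsProbabilityMeasure P] (hX : ∀ i, Measurable (X i))
    (hind : iIndepFun X P) {Φ : (ℕ → Option Bool) → ℝ} {T : ℕ}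
    (hΦ : ∀ a a', (∀ i < T, a i = a' i) → Φ a = Φ a') (w : N → ℝ) :
    ∫ ω, Φ (fun i => f (X i ω)) * w (X T ω) ∂P =
      (∫ ω, Φ (fun i => f (X i ω)) ∂P) * ∫ ω, w (X T ω) ∂P := by
  obtain ⟨G, hG⟩ := exists_factor f hΦ
  simp_rw [fun ω => hG (fun i => X i ω)]
  have h := hind.indepFun_finset (Finset.range T) {T} (by simp) hX
  have h' := h.comp (φ := G) (ψ := fun g => w (g ⟨T, Finset.mem_singleton_self T⟩))
    (measurable_of_finite _) (measurable_of_finite _)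
  have hU : Measurable fun ω => fun i : Finset.range T => X i ω :=
    measurable_pi_lambda _ fun i => hX i
  exact h'.integral_fun_mul_eq_mul_integral
    ((measurable_of_finite G).comp hU).aestronglyMeasurable
    ((measurable_of_finite w).comp (hX T)).aestronglyMeasurable

theorem integral_expTally_le [IsProbabilityMeasure P] (hX : ∀ i, Measurable (X i))
    (hind : iIndepFun X P)
    (hunif : ∀ i t, P {ω | X i ω = t} = (Fintype.card N : ℝ≥0∞)⁻¹)
    {p : ℝ} (h0 : 0 ≤ p) (h1 : p ≤ 1) (t : ℝ)
    (hp : ((Finset.univ.filter fun x => f x = some true).card : ℝ) =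
      p * (Finset.univ.filter fun x => f x ≠ none).card) (k T : ℕ) :
    ∫ ω, expTally k t p T (fun i => f (X i ω)) ∂P ≤ 1 := by
  induction T with
  | zero => simp [expTally]
  | succ T ih =>
    have c0 : ∀ a a' : ℕ → Option Bool, (∀ i < T, a i = a' i) →
        expTally k t p T a = expTally k t p T a' := fun a a' h => by
      unfold expTally
      rw [(tally_congr h true).2, (tally_congr h false).2]
    have c1 : ∀ a a' : ℕ → Option Bool, (∀ i < T, a i = a' i) →
        (if k ≤ responses a T then expTally k t p T a else 0) =
        (if k ≤ responses a' T then expTally k t p T a' else 0) := fun a a' h => by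
      rw [c0 a a' h, (tally_congr (k := k) h true).1]
    have c2 : ∀ a a' : ℕ → Option Bool, (∀ i < T, a i = a' i) →
        (if k ≤ responses a T then 0 else expTally k t p T a) =
        (if k ≤ responses a' T then 0 else expTally k t p T a') := fun a a' h => by
      rw [c0 a a' h, (tally_congr (k := k) h true).1]
    have c3 : ∀ a a' : ℕ → Option Bool, (∀ i < T + 1, a i = a' i) →
        (if k ≤ responses a T then 0 else expTally k t p T a) * stepWeight t p (a T) =
        (if k ≤ responses a' T then 0 else expTally k t p T a') * stepWeight t p (a' T) :=
      fun a a' h => by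
        rw [c2 a a' fun i hi => h i (by omega), h T (by omega)]
    simp_rw [expTally_succ]
    -- Where the sample is complete the process has stopped; elsewhere its value depends on the
    -- first `T` queries only and is independent of the next target.
    rw [integral_add (integrable_of_prefix f hX c1) (integrable_of_prefix f hX c3)]
    rw [integral_prefix_mul f hX hind c2 (fun x => stepWeight t p (f x)),
      integral_comp_uniform (hX T) (hunif T) (fun x => stepWeight t p (f x))]
    have hN : (0 : ℝ) < Fintype.card N := by
      have : Nonempty Ω := by
        by_contra h
        rw [not_nonempty_iff] at h
        have := measure_univ (μ := P)
        simp [Set.univ_eq_empty_iff.2 h] at this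
      have : Nonempty N := this.map (X 0)
      exact_mod_cast Fintype.card_pos
    have hw : (Fintype.card N : ℝ)⁻¹ * ∑ x, stepWeight t p (f x) ≤ 1 := by
      rw [inv_mul_le_iff₀ hN, mul_one]
      exact sum_stepWeight_le f h0 h1 t hp
    have hnn : 0 ≤ ∫ ω, (if k ≤ responses (fun i => f (X i ω)) T then 0 else
        expTally k t p T (fun i => f (X i ω))) ∂P :=
      integral_nonneg fun ω => by
        dsimp only
        split_ifs
        · exact le_rfl
        · exact (Real.exp_pos _).le
    calc _ ≤ (∫ ω, (if k ≤ responses (fun i => f (X i ω)) T then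
          expTally k t p T (fun i => f (X i ω)) else 0) ∂P) +
        (∫ ω, (if k ≤ responses (fun i => f (X i ω)) T then 0 else
          expTally k t p T (fun i => f (X i ω))) ∂P) * 1 := by
          gcongr
      _ = ∫ ω, expTally k t p T (fun i => f (X i ω)) ∂P := by
          rw [mul_one, ← integral_add (integrable_of_prefix f hX c1) (integrable_of_prefix f hX c2)]
          congr 1
          funext ω
          split_ifs <;> simp
      _ ≤ 1 := ih

/-- By the second Borel–Cantelli lemma the responding target `x₀` is queried infinitely often. -/
theorem ae_exists_le_responses [IsProbabilityMeasure P] (hX : ∀ i, Measurable (X i))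
    (hind : iIndepFun X P)
    (hunif : ∀ i t, P {ω | X i ω = t} = (Fintype.card N : ℝ≥0∞)⁻¹)
    {x₀ : N} (hx₀ : f x₀ ≠ none) (k : ℕ) :
    ∀ᵐ ω ∂P, ∃ T, k ≤ responses (fun i => f (X i ω)) T := by
  set s : ℕ → Set Ω := fun i => X i ⁻¹' {x₀} with hs
  have hm : ∀ i, MeasurableSet (s i) := fun i => hX i (measurableSet_singleton _)
  have hsind : iIndepSet s P := by
    rw [iIndepSet_iff_meas_biInter hm]
    exact fun S => hind.meas_biInter fun i _ => ⟨{x₀}, measurableSet_singleton _, rfl⟩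
  have hsum : ∑' n, P (s n) = ⊤ := by
    have : ∀ n, P (s n) = (Fintype.card N : ℝ≥0∞)⁻¹ := fun n => hunif n x₀
    simp_rw [this]
    exact ENNReal.tsum_const_eq_top_of_ne_zero (by simp)
  have h1 := measure_limsup_eq_one hm hsind hsum
  have h2 : ∀ᵐ ω ∂P, ω ∈ Filter.limsup s Filter.atTop :=
    (prob_compl_eq_zero_iff (MeasurableSet.measurableSet_limsup hm)).2 h1
  filter_upwards [h2] with ω hω
  rw [Filter.mem_limsup_iff_frequently_mem, Filter.frequently_atTop] at hω
  induction k with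
  | zero => exact ⟨0, le_rfl⟩
  | succ k ih =>
    obtain ⟨T, hT⟩ := ih
    obtain ⟨T', hT', h⟩ := hω T
    refine ⟨T' + 1, ?_⟩
    rw [responses_succ]
    have h' : X T' ω = x₀ := h
    rw [h', if_neg hx₀]
    exact Nat.succ_le_succ (hT.trans (responses_mono _ hT'))

/-- **Hoeffding's inequality** for the first `k` responses, if the targets of the queries are
independent and uniformly distributed. -/
theorem measure_ones_le [IsProbabilityMeasure P] (hX : ∀ i, Measurable (X i))
    (hind : iIndepFun X P)
    (hunif : ∀ i t, P {ω | X i ω = t} = (Fintype.card N : ℝ≥0∞)⁻¹)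
    {x₀ : N} (hx₀ : f x₀ ≠ none) {p : ℝ}
    (hp : ((Finset.univ.filter fun x => f x = some true).card : ℝ) =
      p * (Finset.univ.filter fun x => f x ≠ none).card) (k : ℕ) {s : ℝ} (hs : 0 ≤ s) :
    P.real {ω | (ones k (fun i => f (X i ω)) : ℝ) ≤ k * (p - s)} ≤ Real.exp (-2 * k * s ^ 2) := by
  set y := (Finset.univ.filter fun x => f x = some true).card
  set r := (Finset.univ.filter fun x => f x ≠ none).card
  have hr : 0 < (r : ℝ) := by
    exact_mod_cast Finset.card_pos.2 ⟨x₀, by simp [hx₀]⟩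
  have hyr : (y : ℝ) ≤ r := by
    exact_mod_cast Finset.card_le_card fun x hx => by
      simp only [Finset.mem_filter, Finset.mem_univ, true_and] at hx ⊢
      simp [hx]
  have h0 : 0 ≤ p := nonneg_of_mul_nonneg_left (hp ▸ Nat.cast_nonneg y) hr
  have h1 : p ≤ 1 := by
    by_contra h
    push Not at h
    nlinarith
  set A : ℕ → Set Ω := fun T => {ω | k ≤ responses (fun i => f (X i ω)) T ∧
    (ones k (fun i => f (X i ω)) : ℝ) ≤ k * (p - s)} with hA
  have hAmono : Monotone A := fun T T' h ω hω => ⟨hω.1.trans (responses_mono _ h), hω.2⟩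
  -- Chernoff bound with `t = 4 * s`, which maximizes `t * s - t ^ 2 / 8`; the maximum is `2 * s ^
  -- 2`. It needs the sample to be complete by time `T`; afterwards `T` tends to infinity.
  have hbound : ∀ T, P.real (A T) ≤ Real.exp (-2 * k * s ^ 2) := by
    intro T
    have c0 : ∀ a a' : ℕ → Option Bool, (∀ i < T, a i = a' i) →
        expTally k (4 * s) p T a = expTally k (4 * s) p T a' := fun a a' h => by
      unfold expTally
      rw [(tally_congr h true).2, (tally_congr h false).2]
    have hmk := mul_meas_ge_le_integral_of_nonneg (μ := P)
      (f := fun ω => expTally k (4 * s) p T (fun i => f (X i ω)))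
      (Filter.Eventually.of_forall fun ω => (Real.exp_pos _).le) (integrable_of_prefix f hX c0)
      (Real.exp (2 * k * s ^ 2))
    have hle := hmk.trans (integral_expTally_le f hX hind hunif h0 h1 (4 * s) hp k T)
    have hsub : A T ⊆ {ω | Real.exp (2 * k * s ^ 2) ≤
        expTally k (4 * s) p T (fun i => f (X i ω))} := by
      rintro ω ⟨hω1, hω2⟩
      change Real.exp (2 * k * s ^ 2) ≤ Real.exp _
      have e := tally_add_tally k (fun i => f (X i ω)) T
      rw [min_eq_left hω1] at e
      rw [ones_eq_tally_of_le_responses hω1] at hω2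
      have e' : (tally k (fun i => f (X i ω)) true T : ℝ) +
        tally k (fun i => f (X i ω)) false T = k := by exact_mod_cast e
      rw [Real.exp_le_exp, e']
      nlinarith
    have := measureReal_mono (μ := P) hsub
    rw [show -2 * (k : ℝ) * s ^ 2 = -(2 * k * s ^ 2) by ring, Real.exp_neg, ← one_div,
      le_div_iff₀ (Real.exp_pos _), mul_comm]
    exact (mul_le_mul_of_nonneg_left this (Real.exp_pos _).le).trans hle
  have hU : P (⋃ T, A T) ≤ ENNReal.ofReal (Real.exp (-2 * k * s ^ 2)) := by
    rw [hAmono.measure_iUnion]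
    refine iSup_le fun T => ?_
    rw [← ofReal_measureReal]
    exact ENNReal.ofReal_le_ofReal (hbound T)
  have hsub : P {ω | (ones k (fun i => f (X i ω)) : ℝ) ≤ k * (p - s)} ≤ P (⋃ T, A T) := by
    refine measure_mono_ae ?_
    filter_upwards [ae_exists_le_responses f hX hind hunif hx₀ k] with ω ⟨T, hT⟩ hω
    exact Set.mem_iUnion.2 ⟨T, hT, hω⟩
  rw [measureReal_def]
  exact ENNReal.toReal_le_of_le_ofReal (Real.exp_pos _).le (hsub.trans hU)

end Sampling

/-! ### Counting nodes; measurability and independence -/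

open Classical in
/-- The number of honest nodes with a given property. -/
def count {h : ℕ} (S : Fin h → Prop) : ℕ := (Finset.univ.filter S).card

theorem count_mono {h : ℕ} {S S' : Fin h → Prop} (hS : ∀ j, S j → S' j) : count S ≤ count S' := by
  classical
  exact Finset.card_le_card fun j hj => by
    simp only [Finset.mem_filter, Finset.mem_univ, true_and] at hj ⊢
    exact hS j hj

open Classical in
theorem count_eq_sum {h : ℕ} (S : Fin h → Prop) :
    (count S : ℝ) = ∑ j, if S j then (1 : ℝ) else 0 := by
  unfold count
  rw [Finset.card_filter]
  push_cast
  rfl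

theorem count_add_count_not {h : ℕ} (S : Fin h → Prop) : count S + count (fun j => ¬ S j) = h := by
  classical
  unfold count
  rw [Finset.card_filter_add_card_filter_not]
  simp

section Measurability

variable {Ω : Type*} [MeasurableSpace Ω]

theorem measurable_count {h : ℕ} {S : Ω → Fin h → Prop} (hS : ∀ j, MeasurableSet {ω | S ω j}) :
    Measurable fun ω => (count (S ω) : ℝ) := by
  classical
  simp_rw [count_eq_sum]
  refine Finset.measurable_sum _ fun j _ => ?_
  exact Measurable.ite (hS j) measurable_const measurable_const

theorem measurable_responses {ans : Ω → ℕ → Option Bool}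
    (h : ∀ i r, MeasurableSet {ω | ans ω i = r}) (T : ℕ) :
    Measurable fun ω => responses (ans ω) T := by
  induction T with
  | zero => simp
  | succ T ih =>
    simp_rw [responses_succ]
    exact ih.add (Measurable.ite (h T none) measurable_const measurable_const)

theorem measurable_tally (k : ℕ) {ans : Ω → ℕ → Option Bool}
    (h : ∀ i r, MeasurableSet {ω | ans ω i = r}) (c : Bool) (T : ℕ) :
    Measurable fun ω => tally k (ans ω) c T := by
  induction T with
  | zero => simp
  | succ T ih =>
    simp_rw [tally_succ]
    refine ih.add (Measurable.ite ?_ measurable_const measurable_const)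
    exact (h T (some c)).inter (measurable_responses h T measurableSet_Iio)

/-- `ones` is the supremum of countably many measurable tallies. -/
theorem measurable_ones (k : ℕ) {ans : Ω → ℕ → Option Bool}
    (h : ∀ i r, MeasurableSet {ω | ans ω i = r}) :
    Measurable fun ω => ones k (ans ω) := by
  refine measurable_of_Iic fun n => ?_
  have : (fun ω => ones k (ans ω)) ⁻¹' Set.Iic n =
      ⋂ T, {ω | tally k (ans ω) true T ≤ n} := by
    ext ω
    simp only [Set.mem_preimage, Set.mem_Iic, Set.mem_iInter, Set.mem_ofPred_eq]
    refine ⟨fun h T => (tally_le_ones _ _ _).trans h, fun h => ?_⟩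
    obtain ⟨T₀, h₀⟩ := exists_tally_eq_ones k (ans ω)
    rw [← h₀ T₀ le_rfl]
    exact h T₀
  rw [this]
  exact MeasurableSet.iInter fun T => measurable_tally k h true T measurableSet_Iic

end Measurability

/-- **Hoeffding's inequality** for the number of independent events that occur. -/
theorem measure_count_ge_le {Ω : Type*} [MeasurableSpace Ω] {P : Measure Ω}
    [IsProbabilityMeasure P] {h : ℕ} (hh : 0 < h) {β : Type*} [MeasurableSpace β]
    {Y : Fin h → Ω → β} (hY : ∀ j, Measurable (Y j)) (hind : iIndepFun Y P) {S : Set β}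
    (hS : MeasurableSet S) {κ δ : ℝ} (hκ : ∀ j, P.real {ω | Y j ω ∈ S} ≤ κ) (hδ : 0 ≤ δ) :
    P.real {ω | (h : ℝ) * (κ + δ) ≤ count fun j => Y j ω ∈ S} ≤ Real.exp (-2 * h * δ ^ 2) := by
  classical
  set Z : Fin h → Ω → ℝ := fun j ω => S.indicator (fun _ => (1 : ℝ)) (Y j ω) with hZ
  have hind' : Measurable (S.indicator (fun _ => (1 : ℝ))) := measurable_const.indicator hS
  have hZm : ∀ j, Measurable (Z j) := fun j => hind'.comp (hY j)
  have hZint : ∀ j, ∫ ω, Z j ω ∂P = P.real {ω | Y j ω ∈ S} := fun j => by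
    have : Z j = (Y j ⁻¹' S).indicator (fun _ => (1 : ℝ)) := by
      funext ω
      simp [hZ, Set.indicator_apply]
    rw [this, integral_indicator_const _ (hY j hS)]
    simp [Set.preimage]
  have hZind : iIndepFun (fun j ω => Z j ω - ∫ x, Z j x ∂P) P :=
    hind.comp (fun j b => S.indicator (fun _ => (1 : ℝ)) b - ∫ x, Z j x ∂P)
      fun j => hind'.sub_const _
  have hsub : ∀ j ∈ (Finset.univ : Finset (Fin h)), HasSubgaussianMGF
      (fun ω => Z j ω - ∫ x, Z j x ∂P) ((‖(1 : ℝ) - 0‖₊ / 2) ^ 2) P := fun j _ =>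
    hasSubgaussianMGF_of_mem_Icc (hZm j).aemeasurable (Filter.Eventually.of_forall fun ω => by
      simp only [hZ, Set.indicator_apply]
      split_ifs <;> simp)
  have hh' : (0 : ℝ) < h := Nat.cast_pos.2 hh
  have := HasSubgaussianMGF.measure_sum_ge_le_of_iIndepFun hZind hsub
    (ε := h * δ) (by positivity)
  refine (measureReal_mono ?_).trans (this.trans (le_of_eq ?_))
  · intro ω hω
    simp only [Set.mem_ofPred_eq] at hω ⊢
    rw [count_eq_sum] at hω
    have e1 : ∑ j, (Z j ω - ∫ x, Z j x ∂P) =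
        (∑ j, if Y j ω ∈ S then (1 : ℝ) else 0) - ∑ j, P.real {ω | Y j ω ∈ S} := by
      rw [Finset.sum_sub_distrib]
      simp_rw [hZint]
      rfl
    have e2 : ∑ j, P.real {ω | Y j ω ∈ S} ≤ h * κ := by
      refine (Finset.sum_le_card_nsmul _ _ κ fun j _ => hκ j).trans (le_of_eq ?_)
      simp
    rw [e1]
    linarith
  · congr 1
    rw [sub_zero, nnnorm_one, Finset.sum_const, Finset.card_univ, Fintype.card_fin]
    push_cast
    rw [nsmul_eq_mul]
    field_simp

/-- Rows of a doubly indexed independent family are independent. -/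
theorem iIndepFun_rows {Ω ι κ N : Type*} [MeasurableSpace Ω] {P : Measure Ω}
    [MeasurableSpace N] {X : ι × κ → Ω → N} (hX : ∀ x, Measurable (X x)) (hind : iIndepFun X P) :
    iIndepFun (fun i ω k => X (i, k) ω) P := by
  have := hind.isProbabilityMeasure
  have hpr : ∀ x, IsProbabilityMeasure (P.map (X x)) := fun x =>
    Measure.isProbabilityMeasure_map (hX x).aemeasurable
  have hrow : ∀ i, Measurable fun ω k => X (i, k) ω := fun i =>
    measurable_pi_lambda _ fun k => hX _
  rw [iIndepFun_iff_map_fun_eq_infinitePi_map hrow]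
  have h1 := hind.map_fun_eq_infinitePi_map hX
  have h2 : ∀ i, P.map (fun ω k => X (i, k) ω) = Measure.infinitePi fun k => P.map (X (i, k)) :=
    fun i => (hind.precomp (g := fun k => (i, k)) (Prod.mk_right_injective i)).map_fun_eq_infinitePi_map
      fun k => hX _
  simp_rw [h2]
  -- Currying carries the product law of the whole family to the product of the laws of the rows.
  rw [← Measure.infinitePi_map_curry (fun i k => P.map (X (i, k))), ← h1,
    Measure.map_map (MeasurableEquiv.measurable _) (measurable_pi_lambda _ hX)]
  rfl

instance (p : Params) : MeasurableSingletonClass p.Node where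
  measurableSet_singleton _ := measurableSet_sum_iff.2
    ⟨(Set.toFinite _).measurableSet, (Set.toFinite _).measurableSet⟩

/-! ### Exceptional samples in one round -/

namespace Execution

variable {p : Params} {θ : ℝ} {Ω : Type*} [mΩ : MeasurableSpace Ω] {P : Measure Ω}
  (E : Execution p θ P)

theorem past_mono : Monotone E.past :=
  monotone_nat_of_le_succ fun m =>
    (E.past_le_pre m).trans ((E.pre_le_mid m).trans (E.mid_le_past m))

theorem mid_le (m : ℕ) : E.mid (m + 1) ≤ mΩ := (E.mid_le_past m).trans (E.past_le _)

theorem pre_le (m : ℕ) : E.pre (m + 1) ≤ mΩ := (E.pre_le_mid m).trans (E.mid_le m)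

theorem measurable_query (m : ℕ) (j : Fin p.honest) (i : ℕ) : Measurable (E.query (m + 1) j i) :=
  measurable_to_countable' fun t => E.mid_le m _ (E.query_meas m j i t)

/-- The node `j` has a sample of `k` responses with an exceptionally small number of `1`'s if the
target `v` of a query responds by `f v`. -/
def lowSample (m : ℕ) (f : p.Node → Option Bool) (x : ℝ) (j : Fin p.honest) : Set Ω :=
  {ω | (ones p.k (fun i => f (E.query (m + 1) j i ω)) : ℝ) ≤ p.k * x}

theorem measurableSet_query_iSup (m : ℕ) (j : Fin p.honest) (i : ℕ) (T : Set p.Node) :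
    MeasurableSet[⨆ x : Fin p.honest × ℕ, MeasurableSpace.comap (E.query (m + 1) x.1 x.2) ⊤]
      {ω | E.query (m + 1) j i ω ∈ T} := by
  refine (le_iSup (fun x : Fin p.honest × ℕ =>
    MeasurableSpace.comap (E.query (m + 1) x.1 x.2) ⊤) (j, i)) _ ?_
  exact ⟨T, trivial, rfl⟩

theorem measurableSet_lowSample (m : ℕ) (f : p.Node → Option Bool) (x : ℝ) (j : Fin p.honest) :
    MeasurableSet[⨆ x : Fin p.honest × ℕ, MeasurableSpace.comap (E.query (m + 1) x.1 x.2) ⊤]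
      (E.lowSample m f x j) := by
  have := @measurable_ones Ω
    (⨆ x : Fin p.honest × ℕ, MeasurableSpace.comap (E.query (m + 1) x.1 x.2) ⊤) p.k
    (fun ω i => f (E.query (m + 1) j i ω))
    (fun i r => E.measurableSet_query_iSup m j i {t | f t = r})
  exact this (t := {n : ℕ | (n : ℝ) ≤ p.k * x}) trivial

variable [IsProbabilityMeasure P]

theorem card_node : Fintype.card p.Node = p.n := by
  simp [Params.n]

section

variable (f : p.Node → Option Bool) {v₀ : p.Node} (hv₀ : f v₀ ≠ none) {x : ℝ}
  (hx : ((Finset.univ.filter fun v => f v = some true).card : ℝ) =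
      x * (Finset.univ.filter fun v => f v ≠ none).card)

include hv₀ hx

theorem measure_lowSample_le (m : ℕ) (j : Fin p.honest) {s : ℝ} (hs : 0 ≤ s) :
    P.real (E.lowSample m f (x - s) j) ≤ Real.exp (-2 * p.k * s ^ 2) := by
  refine measure_ones_le (X := fun i => E.query (m + 1) j i) f
    (fun i => E.measurable_query m j i) ?_ (fun i t => ?_) hv₀ hx p.k hs
  · exact (E.query_iIndep m).precomp (g := fun i => (j, i)) (Prod.mk_right_injective j)
  · rw [card_node]
    exact E.query_unif m j i t

/-- For a fixed `f` the exceptional event is a function of the queries alone, hence independent of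
all information prior to them. -/
theorem measure_inter_lowSample_le (m : ℕ) {A : Set Ω} (hA : MeasurableSet[E.pre (m + 1)] A)
    (j : Fin p.honest) {s : ℝ} (hs : 0 ≤ s) :
    P.real (A ∩ E.lowSample m f (x - s) j) ≤ Real.exp (-2 * p.k * s ^ 2) * P.real A := by
  have := (Indep_iff _ _ P).1 (E.query_indep m) _ _ (E.measurableSet_lowSample m f (x - s) j) hA
  rw [Set.inter_comm, measureReal_def, this, ENNReal.toReal_mul]
  exact mul_le_mul_of_nonneg_right (E.measure_lowSample_le f hv₀ hx m j hs) measureReal_nonneg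

theorem measure_inter_count_lowSample_le (hh : 1 ≤ p.honest) (m : ℕ) {A : Set Ω}
    (hA : MeasurableSet[E.pre (m + 1)] A) {s δ κ : ℝ} (hs : 0 ≤ s)
    (hκ : Real.exp (-2 * p.k * s ^ 2) ≤ κ) (hδ : 0 ≤ δ) :
    P.real (A ∩ {ω | (p.honest : ℝ) * (κ + δ) ≤ count fun j => ω ∈ E.lowSample m f (x - s) j}) ≤
      Real.exp (-2 * p.honest * δ ^ 2) * P.real A := by
  set S : Set Ω := {ω | (p.honest : ℝ) * (κ + δ) ≤
    count fun j => ω ∈ E.lowSample m f (x - s) j} with hS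
  have hSm : MeasurableSet[⨆ x : Fin p.honest × ℕ,
      MeasurableSpace.comap (E.query (m + 1) x.1 x.2) ⊤] S :=
    @measurable_count Ω (⨆ x : Fin p.honest × ℕ,
      MeasurableSpace.comap (E.query (m + 1) x.1 x.2) ⊤) _ _
      (fun j => E.measurableSet_lowSample m f (x - s) j) _ measurableSet_Ici
  have := (Indep_iff _ _ P).1 (E.query_indep m) _ _ hSm hA
  rw [Set.inter_comm, measureReal_def, this, ENNReal.toReal_mul]
  refine mul_le_mul_of_nonneg_right ?_ measureReal_nonneg
  have hrows := iIndepFun_rows (X := fun x : Fin p.honest × ℕ => E.query (m + 1) x.1 x.2)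
    (fun x => E.measurable_query m _ _) (E.query_iIndep m)
  refine measure_count_ge_le (P := P) hh (Y := fun j ω i => E.query (m + 1) j i ω)
    (fun j => measurable_pi_lambda _ fun i => E.measurable_query m j i) hrows
    (S := {y | (ones p.k (fun i => f (y i)) : ℝ) ≤ p.k * (x - s)}) ?_ (fun j => ?_) hδ
  · have : Measurable fun y : ℕ → p.Node => ones p.k (fun i => f (y i)) :=
      measurable_ones p.k fun i r =>
        (measurable_pi_apply (X := fun _ : ℕ => p.Node) i)
          (Set.toFinite {t | f t = r}).measurableSet
    exact this (t := {n : ℕ | (n : ℝ) ≤ p.k * (x - s)}) trivial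
  · exact (E.measure_lowSample_le f hv₀ hx m j hs).trans hκ

end

end Execution

/-! ### Arithmetic of the parameters -/

namespace Params

variable {p : Params}

theorem n_pos (hh : 1 ≤ p.honest) : (0 : ℝ) < p.n := by
  have : 0 < p.n := by unfold n; omega
  exact_mod_cast this

theorem one_sub_q_mul_n (hh : 1 ≤ p.honest) : (1 - p.q) * p.n = p.honest := by
  have := n_pos hh
  unfold q
  rw [sub_mul, div_mul_cancel₀ _ this.ne']
  unfold n
  push_cast
  ring

theorem q_mul_n (hh : 1 ≤ p.honest) : p.q * p.n = p.adversarial :=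
  div_mul_cancel₀ _ (n_pos hh).ne'

theorem q_nonneg : 0 ≤ p.q := div_nonneg (Nat.cast_nonneg _) (Nat.cast_nonneg _)

theorem one_sub_q_pos (hh : 1 ≤ p.honest) : 0 < 1 - p.q := by
  have h1 := one_sub_q_mul_n hh
  have h2 : (1 : ℝ) ≤ p.honest := by exact_mod_cast hh
  exact pos_of_mul_pos_left (by linarith) (n_pos hh).le

theorem ε_pos : 0 < p.ε := Real.exp_pos _

theorem ε_lt_half (hh : 1 ≤ p.honest) (h_β : p.β < 1 / 2) (h_φ : 0 < p.φ) : p.ε < 1 / 2 := by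
  have h1 := one_sub_q_pos hh
  have : (p.β - p.q) / (2 * (1 - p.q)) ≤ 1 / 2 := by
    rw [div_le_div_iff₀ (by linarith) (by norm_num)]
    linarith
  unfold φ at h_φ
  linarith

theorem k_pos (hh : 1 ≤ p.honest) (h_β : p.β < 1 / 2) (h_φ : 0 < p.φ) : 0 < p.k := by
  by_contra h
  have h0 : p.k = 0 := by omega
  have := ε_lt_half hh h_β h_φ
  rw [ε, h0] at this
  norm_num at this

/-- The largest number of honest nodes in a minority for which the majority prevails. -/
def minority (p : Params) : ℝ := p.n * ((p.β - p.q) / 2)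

/-- This explains `φ`: it is the slack between the error probability `ε` of a node and the tolerated
proportion of errors among honest nodes. -/
theorem honest_mul_ε_add_φ (hh : 1 ≤ p.honest) : p.honest * (p.ε + p.φ) = p.minority := by
  have h1 := one_sub_q_pos hh
  rw [← one_sub_q_mul_n hh, φ, minority]
  field_simp
  ring

/-- Two opinions cannot both have all but a minority of the honest nodes. -/
theorem minority_lt (hh : 1 ≤ p.honest) (h_β : p.β < 1 / 2) : 2 * p.minority < p.honest := by
  rw [← one_sub_q_mul_n hh, minority]
  have := n_pos hh
  nlinarith

end Params

/-! ### Splitting into fibres; measurability of states and decisions -/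

/-- A bound for an event may be proved on the fibres of a finite-valued variable. -/
theorem measureReal_le_of_fibers {Ω Y : Type*} [MeasurableSpace Ω] {P : Measure Ω}
    [IsFiniteMeasure P] [Fintype Y] {Z : Ω → Y} (hZ : ∀ y, MeasurableSet {ω | Z ω = y})
    {S T : Set Ω} {c : ℝ}
    (h : ∀ y, P.real (S ∩ {ω | Z ω = y}) ≤ c * P.real (T ∩ {ω | Z ω = y})) :
    P.real S ≤ c * P.real T := by
  classical
  have hS : S = ⋃ y, S ∩ {ω | Z ω = y} := by
    ext ω
    simp
  have hT : P.real T = ∑ y, P.real (T ∩ {ω | Z ω = y}) := by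
    have hc : ((Finset.univ : Finset Y) : Set Y).PairwiseDisjoint fun y => {ω : Ω | Z ω = y} := by
      intro y _ y' _ hyy'
      exact Set.disjoint_left.2 fun ω h1 h2 => hyy' (h1.symm.trans h2)
    have h1 : ∀ y, P.real (T ∩ {ω | Z ω = y}) = (P.restrict T).real {ω | Z ω = y} := fun y => by
      rw [measureReal_restrict_apply (hZ y), Set.inter_comm]
    simp_rw [h1]
    rw [← measureReal_biUnion_finset hc fun y _ => hZ y]
    have h2 : (⋃ y ∈ (Finset.univ : Finset Y), {ω | Z ω = y}) = Set.univ := by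
      ext ω
      simp
    rw [h2, measureReal_restrict_apply_univ]
  calc P.real S = P.real (⋃ y, S ∩ {ω | Z ω = y}) := by rw [← hS]
    _ ≤ ∑ y, P.real (S ∩ {ω | Z ω = y}) := measureReal_iUnion_fintype_le _
    _ ≤ ∑ y, c * P.real (T ∩ {ω | Z ω = y}) := Finset.sum_le_sum fun y _ => h y
    _ = c * P.real T := by rw [← Finset.mul_sum, hT]

instance : Countable NodeState :=
  Function.Injective.countable (f := fun s : NodeState => (s.opinion, s.streak)) <| by
    rintro ⟨a, b⟩ ⟨c, d⟩ h
    simpa using h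

namespace Execution

variable {p : Params} {θ : ℝ} {Ω : Type*} [mΩ : MeasurableSpace Ω] {P : Measure Ω}
  (E : Execution p θ P)

/-- The opinions of the honest nodes after round `m`. -/
def opinions (ω : Ω) (m : ℕ) : Fin p.honest → Bool := fun j => (E.state ω m j).opinion

open Classical in
/-- The outcome for the node `j` of the comparison with the threshold in round `m + 1`. -/
def decision (ω : Ω) (m : ℕ) (j : Fin p.honest) : Bool :=
  decide (E.threshold (m + 1) ω ≤
    (p.k : ℝ)⁻¹ * (ones p.k (E.answer ω (m + 1) (E.opinions ω m) j) : ℝ))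

theorem state_succ (ω : Ω) (m : ℕ) (j : Fin p.honest) :
    E.state ω (m + 1) j = (E.state ω m j).step p (m + 1) (E.decision ω m j) := rfl

theorem decision_eq_true_iff (ω : Ω) (m : ℕ) (j : Fin p.honest) :
    E.decision ω m j = true ↔ E.threshold (m + 1) ω ≤
      (p.k : ℝ)⁻¹ * (ones p.k (E.answer ω (m + 1) (E.opinions ω m) j) : ℝ) := by
  simp [decision]

theorem measurableSet_opinions {m : ℕ}
    (h : ∀ j s, MeasurableSet[E.past m] {ω | E.state ω m j = s}) (ξ : Fin p.honest → Bool) :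
    MeasurableSet[E.past m] {ω | E.opinions ω m = ξ} := by
  have : {ω | E.opinions ω m = ξ} =
      ⋂ j, ⋃ s : {s : NodeState // s.opinion = ξ j}, {ω | E.state ω m j = s} := by
    ext ω
    simp only [Set.mem_ofPred_eq, Set.mem_iInter, Set.mem_iUnion, funext_iff, opinions]
    exact forall_congr' fun j => ⟨fun h => ⟨⟨_, h⟩, rfl⟩, fun ⟨⟨s, hs⟩, h⟩ => h ▸ hs⟩
  rw [this]
  exact MeasurableSet.iInter fun j => MeasurableSet.iUnion fun s => h j s

/-- Measurability of the states is a hypothesis here because this serves as the induction step of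
`measurableSet_state`. -/
theorem measurableSet_decision_of_state {m : ℕ}
    (h : ∀ j s, MeasurableSet[E.past m] {ω | E.state ω m j = s}) (j : Fin p.honest) (v : Bool) :
    MeasurableSet[E.past (m + 1)] {ω | E.decision ω m j = v} := by
  have hmid : E.mid (m + 1) ≤ E.past (m + 1) := E.mid_le_past m
  have hpm : E.past m ≤ E.mid (m + 1) := (E.past_le_pre m).trans (E.pre_le_mid m)
  have hans : ∀ i r, MeasurableSet[E.mid (m + 1)]
      {ω | E.answer ω (m + 1) (E.opinions ω m) j i = r} := by
    intro i r
    have : {ω | E.answer ω (m + 1) (E.opinions ω m) j i = r} =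
        (⋃ ξ : Fin p.honest → Bool, ⋃ j' : {j' // some (ξ j') = r},
          {ω | E.opinions ω m = ξ} ∩ {ω | E.query (m + 1) j i ω = Sum.inl j'.1}) ∪
        ⋃ v, {ω | E.query (m + 1) j i ω = Sum.inr v} ∩ {ω | E.reply (m + 1) ω v j i = r} := by
      ext ω
      simp only [Set.mem_ofPred_eq, Set.mem_union, Set.mem_iUnion, Set.mem_inter_iff, answer]
      rcases hq : E.query (m + 1) j i ω with j' | v
      · simp
      · simp
    rw [this]
    refine MeasurableSet.union ?_ ?_
    · exact MeasurableSet.iUnion fun ξ => MeasurableSet.iUnion fun j' =>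
        (hpm _ (E.measurableSet_opinions h ξ)).inter (E.query_meas m j i _)
    · exact MeasurableSet.iUnion fun v => (E.query_meas m j i _).inter (E.reply_meas m v j i r)
  have hones := @measurable_ones Ω (E.mid (m + 1)) p.k _ hans
  have htrue : MeasurableSet[E.past (m + 1)] {ω | E.decision ω m j = true} := by
    simp_rw [decision_eq_true_iff]
    refine measurableSet_le (mδ := E.past (m + 1)) (E.threshold_meas m) ?_
    have h' : Measurable[E.past (m + 1)] fun ω =>
        ones p.k (E.answer ω (m + 1) (E.opinions ω m) j) := fun S hS => hmid _ (hones hS)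
    exact (measurable_from_top (f := fun r : ℕ => (p.k : ℝ)⁻¹ * (r : ℝ))).comp h'
  cases v
  · have : {ω | E.decision ω m j = false} = {ω | E.decision ω m j = true}ᶜ := by
      ext ω
      simp
    rw [this]
    exact htrue.compl
  · exact htrue

theorem measurableSet_state (m : ℕ) (j : Fin p.honest) (s : NodeState) :
    MeasurableSet[E.past m] {ω | E.state ω m j = s} := by
  induction m generalizing j s with
  | zero =>
    have htrue : ∀ v, MeasurableSet[E.past 0] {ω | E.init ω j = v} := by
      rintro (_ | _)
      · have : {ω | E.init ω j = false} = {ω | E.init ω j = true}ᶜ := by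
          ext ω
          simp
        rw [this]
        exact (E.init_meas j).compl
      · exact E.init_meas j
    have : {ω | E.state ω 0 j = s} = ⋃ v : {v : Bool // (⟨v, 0⟩ : NodeState) = s},
        {ω | E.init ω j = v} := by
      ext ω
      simp only [Set.mem_ofPred_eq, Set.mem_iUnion, state]
      exact ⟨fun h => ⟨⟨_, h⟩, rfl⟩, fun ⟨⟨v, hv⟩, h⟩ => h ▸ hv⟩
    rw [this]
    exact MeasurableSet.iUnion fun v => htrue v
  | succ m ih =>
    have : {ω | E.state ω (m + 1) j = s} =
        ⋃ x : {x : NodeState × Bool // x.1.step p (m + 1) x.2 = s},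
          {ω | E.state ω m j = x.1.1} ∩ {ω | E.decision ω m j = x.1.2} := by
      ext ω
      simp only [Set.mem_ofPred_eq, Set.mem_iUnion, Set.mem_inter_iff, state_succ]
      refine ⟨fun h => ⟨⟨(_, _), h⟩, rfl, rfl⟩, ?_⟩
      rintro ⟨⟨⟨s', v⟩, hs⟩, h1, h2⟩
      rw [h1, h2]
      exact hs
    rw [this]
    exact MeasurableSet.iUnion fun x => (E.past_mono (Nat.le_succ m) _ (ih j _)).inter
      (E.measurableSet_decision_of_state (fun j s => ih j s) j _)

theorem measurableSet_opinions_eq (m : ℕ) (ξ : Fin p.honest → Bool) :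
    MeasurableSet[E.past m] {ω | E.opinions ω m = ξ} :=
  E.measurableSet_opinions (fun j s => E.measurableSet_state m j s) ξ

theorem measurableSet_decision (m : ℕ) (j : Fin p.honest) (v : Bool) :
    MeasurableSet[E.past (m + 1)] {ω | E.decision ω m j = v} :=
  E.measurableSet_decision_of_state (fun j s => E.measurableSet_state m j s) j v

/-! ### Least favourable samples and the threshold -/

/-- The least favourable sample for the opinion `c`: honest nodes with the opinions `ξ` say
whether these equal `c`, adversarial nodes with preferences `b` answer by `a` according to
whether these equal `c`. -/
def sampler (a : Bool → Option Bool) (c : Bool) (ξ : Fin p.honest → Bool)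
    (b : Fin p.adversarial → Bool) : p.Node → Option Bool :=
  Sum.elim (fun j => some (ξ j == c)) (fun v => a (b v == c))

theorem card_filter_sampler (a : Bool → Option Bool) (c : Bool) (ξ : Fin p.honest → Bool)
    (b : Fin p.adversarial → Bool) (Q : Option Bool → Prop) [DecidablePred Q] :
    (Finset.univ.filter fun v : p.Node => Q (sampler a c ξ b v)).card =
      (Finset.univ.filter fun j => Q (some (ξ j == c))).card +
        (Finset.univ.filter fun v => Q (a (b v == c))).card := by
  rw [Finset.card_filter, Fintype.sum_sum_type, Finset.card_filter, Finset.card_filter]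
  rfl

/-- In round `m + 1` the answers of the adversarial nodes are at least as favourable to either
opinion as described by `a` and the preferences `bit`. -/
def Constrained (m : ℕ) (a : Bool → Option Bool) (bit : Ω → Fin p.adversarial → Bool) : Prop :=
  ∀ ω v j i c,
    (a (bit ω v == c) = some true → E.reply (m + 1) ω v j i = some c) ∧
    (E.reply (m + 1) ω v j i = some (!c) → a (bit ω v == c) = some false)

theorem constrained_arbitrary (m : ℕ) (bit : Ω → Fin p.adversarial → Bool) :
    E.Constrained m (fun _ => some false) bit := fun ω v j i c => by simp

variable {E} in
theorem Constrained.dominated {m : ℕ} {a : Bool → Option Bool}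
    {bit : Ω → Fin p.adversarial → Bool} (h : E.Constrained m a bit) (ω : Ω) (j : Fin p.honest)
    (c : Bool) :
    Dominated (fun i => sampler a c (E.opinions ω m) (bit ω) (E.query (m + 1) j i ω))
      (agree c (E.answer ω (m + 1) (E.opinions ω m) j)) := by
  intro i
  simp only [agree, answer]
  rcases E.query (m + 1) j i ω with j' | v
  · simp [sampler]
  · obtain ⟨h1, h2⟩ := h ω v j i c
    simp only [sampler, Sum.elim_inr]
    refine ⟨fun h => by simp [h1 h], fun h => h2 ?_⟩
    rcases hr : E.reply (m + 1) ω v j i with _ | _ | _ <;> cases c <;> simp_all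

variable {E} in
/-- A node whose sample is not exceptional decides for `c` if the threshold permits. -/
theorem Constrained.decision_eq {m : ℕ} {a : Bool → Option Bool}
    {bit : Ω → Fin p.adversarial → Bool} (h : E.Constrained m a bit) (hk : 0 < p.k)
    {ω : Ω} {j : Fin p.honest} {c : Bool} {x : ℝ}
    (hω : ω ∉ E.lowSample m (sampler a c (E.opinions ω m) (bit ω)) x j)
    (hx : (if c then E.threshold (m + 1) ω else 1 - E.threshold (m + 1) ω) ≤ x) :
    E.decision ω m j = c := by
  have hk' : (0 : ℝ) < p.k := Nat.cast_pos.2 hk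
  have hle := (h.dominated ω j c).ones_le p.k
  have hlow : (p.k : ℝ) * x < ones p.k (fun i =>
      sampler a c (E.opinions ω m) (bit ω) (E.query (m + 1) j i ω)) := not_le.1 hω
  have hlt : (p.k : ℝ) * x < ones p.k (agree c (E.answer ω (m + 1) (E.opinions ω m) j)) :=
    hlow.trans_le (by exact_mod_cast hle)
  cases c
  · rw [← Bool.not_eq_true, decision_eq_true_iff, inv_mul_eq_div, le_div_iff₀ hk', not_le]
    -- More than `k * x` answers `0` leave fewer than `k * (1 - x)` answers `1`, too few for a
    -- threshold of at least `1 - x`.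
    have hsum : (ones p.k (E.answer ω (m + 1) (E.opinions ω m) j) : ℝ) +
        ones p.k (agree false (E.answer ω (m + 1) (E.opinions ω m) j)) ≤ p.k := by
      exact_mod_cast ones_add_ones_agree_false_le p.k (E.answer ω (m + 1) (E.opinions ω m) j)
    simp only [Bool.false_eq_true, if_false] at hx
    nlinarith
  · rw [decision_eq_true_iff, inv_mul_eq_div, le_div_iff₀ hk']
    rw [agree_true] at hlt
    simp only [if_true] at hx
    nlinarith

end Execution

/-- The minimum and maximum cut the interval down to the support; the semi-cautious case depends on
this. -/
theorem unifLaw_Ioo_le {β : ℝ} (hβ : β < 1 / 2) {x y D : ℝ}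
    (h : min y (1 - β) - max x β ≤ D * (1 - 2 * β)) :
    unifLaw β (1 - β) (Set.Ioo x y) ≤ ENNReal.ofReal D := by
  have hpos : 0 < 1 - 2 * β := by linarith
  unfold unifLaw
  rw [Measure.map_apply (by fun_prop) measurableSet_Ioo, Measure.restrict_apply
    (measurableSet_Ioo.preimage (by fun_prop))]
  have hsub : (fun t => β + t * (1 - β - β)) ⁻¹' Set.Ioo x y ∩ Set.Icc (0 : ℝ) 1 ⊆
      Set.Icc ((max x β - β) / (1 - 2 * β)) ((min y (1 - β) - β) / (1 - 2 * β)) := by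
    rintro t ⟨⟨h1, h2⟩, h3, h4⟩
    have h1 : x < β + t * (1 - β - β) := h1
    have h2 : β + t * (1 - β - β) < y := h2
    rw [Set.mem_Icc, div_le_iff₀ hpos, le_div_iff₀ hpos, sub_le_iff_le_add, max_le_iff,
      le_sub_iff_add_le, le_min_iff]
    refine ⟨⟨?_, ?_⟩, ?_, ?_⟩ <;> nlinarith
  refine (measure_mono hsub).trans ?_
  rw [Real.volume_Icc]
  refine ENNReal.ofReal_le_ofReal ?_
  rw [← sub_div, div_le_iff₀ hpos]
  linarith

theorem exp_sampling_eq_ε {p : Params} : Real.exp (-2 * p.k * ((p.β - p.q) / 2) ^ 2) = p.ε := by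
  unfold Params.ε
  congr 1
  ring

/-! ### Persistence of a majority -/

namespace Execution

variable {p : Params} {θ : ℝ} {Ω : Type*} [mΩ : MeasurableSpace Ω] {P : Measure Ω}
  (E : Execution p θ P)

/-- After round `m` all but a small minority of the honest nodes have the opinion `c`. -/
def Preconsensus (ω : Ω) (m : ℕ) (c : Bool) : Prop :=
  (count (fun j => E.opinions ω m j ≠ c) : ℝ) ≤ p.minority

/-- In round `m + 1` all but a small minority of the honest nodes decide for `c`. -/
def Prevails (ω : Ω) (m : ℕ) (c : Bool) : Prop :=
  (count (fun j => E.decision ω m j ≠ c) : ℝ) ≤ p.minority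

theorem measurableSet_preconsensus (m : ℕ) (c : Bool) :
    MeasurableSet[E.past m] {ω | E.Preconsensus ω m c} := by
  have : {ω | E.Preconsensus ω m c} = ⋃ ξ : {ξ : Fin p.honest → Bool //
      (count (fun j => ξ j ≠ c) : ℝ) ≤ p.minority}, {ω | E.opinions ω m = ξ} := by
    ext ω
    simp only [Set.mem_ofPred_eq, Set.mem_iUnion, Preconsensus]
    exact ⟨fun h => ⟨⟨_, h⟩, rfl⟩, fun ⟨⟨ξ, hξ⟩, h⟩ => h ▸ hξ⟩
  rw [this]
  exact MeasurableSet.iUnion fun ξ => E.measurableSet_opinions_eq m _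

theorem measurableSet_decision_ne (m : ℕ) (j : Fin p.honest) (c : Bool) :
    MeasurableSet[E.past (m + 1)] {ω | E.decision ω m j ≠ c} :=
  (E.measurableSet_decision m j c).compl

theorem measurableSet_prevails (m : ℕ) (c : Bool) :
    MeasurableSet[E.past (m + 1)] {ω | E.Prevails ω m c} :=
  @measurable_count Ω (E.past (m + 1)) _ _ (fun j => E.measurableSet_decision_ne m j c) _
    measurableSet_Iic

theorem threshold_mem_Icc {m : ℕ} (hm : 1 ≤ m) (ω : Ω) :
    E.threshold (m + 1) ω ∈ Set.Icc p.β (1 - p.β) := by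
  have := E.threshold_mem m ω
  unfold Params.lower Params.upper at this
  rwa [if_neg (by omega), if_neg (by omega)] at this

theorem preconsensus_unique (hh : 1 ≤ p.honest) (h_β : p.β < 1 / 2) {ω : Ω} {m : ℕ} {c c' : Bool}
    (h : E.Preconsensus ω m c) (h' : E.Preconsensus ω m c') : c = c' := by
  by_contra hne
  have hlt := Params.minority_lt hh h_β
  have e := count_add_count_not fun j => E.opinions ω m j ≠ c
  have hle : count (fun j => ¬ E.opinions ω m j ≠ c) ≤ count fun j => E.opinions ω m j ≠ c' :=
    count_mono fun j hj => by
      rw [not_not] at hj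
      rw [hj]
      exact hne
  unfold Preconsensus at h h'
  have e' : (count (fun j => E.opinions ω m j ≠ c) : ℝ) +
    count (fun j => ¬ E.opinions ω m j ≠ c) = p.honest := by exact_mod_cast e
  have hle' : (count (fun j => ¬ E.opinions ω m j ≠ c) : ℝ) ≤
    count fun j => E.opinions ω m j ≠ c' := by exact_mod_cast hle
  linarith

/-- On each fibre of the opinions, decisions against the majority are exceptional samples. -/
theorem exists_lowSample_of_preconsensus (hh : 1 ≤ p.honest) (h_β : p.β < 1 / 2) (h_φ : 0 < p.φ)
    {m : ℕ} (hm : 1 ≤ m) {A : Set Ω} {c : Bool} (hAc : ∀ ω ∈ A, E.Preconsensus ω m c) (ξ : Fin p.honest → Bool)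
    (hξ : (A ∩ {ω | E.opinions ω m = ξ}).Nonempty) :
    ∃ x : ℝ, ((Finset.univ.filter fun v =>
        sampler (p := p) (fun _ => some false) c ξ (fun _ => true) v = some true).card : ℝ) =
        x * (Finset.univ.filter fun v =>
          sampler (p := p) (fun _ => some false) c ξ (fun _ => true) v ≠ none).card ∧
      ∀ ω, E.opinions ω m = ξ → ∀ j, E.decision ω m j ≠ c →
        ω ∈ E.lowSample m (sampler (fun _ => some false) c ξ (fun _ => true))
          (x - (p.β - p.q) / 2) j := by
  have hn := Params.n_pos hh
  refine ⟨(count fun j => ξ j = c) / p.n, ?_, ?_⟩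
  · rw [card_filter_sampler (fun _ => some false) c ξ (fun _ => true) (fun r => r = some true),
      card_filter_sampler (fun _ => some false) c ξ (fun _ => true) (fun r => r ≠ none)]
    have : (p.n : ℝ) = p.honest + p.adversarial := by unfold Params.n; push_cast; rfl
    simp only [Option.some.injEq, beq_iff_eq, Bool.false_eq_true, Finset.filter_false,
      Finset.card_empty, add_zero, ne_eq, reduceCtorEq, not_false_eq_true, Finset.filter_true,
      Finset.card_univ, Fintype.card_fin]
    rw [Nat.cast_add, ← this, div_mul_cancel₀ _ hn.ne', count]
    congr!
  · intro ω hω j hj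
    by_contra hlow
    refine hj ((E.constrained_arbitrary m fun _ _ => true).decision_eq
      (Params.k_pos hh h_β h_φ) (x := (count fun j => ξ j = c) / p.n - (p.β - p.q) / 2)
      (by rwa [hω]) ?_)
    obtain ⟨ω', h1, h2⟩ := hξ
    have hpre := hAc ω' h1
    have h2 : E.opinions ω' m = ξ := h2
    unfold Preconsensus at hpre
    rw [h2] at hpre
    have e : (count (fun j => ξ j = c) : ℝ) + count (fun j => ξ j ≠ c) = p.honest := by
      exact_mod_cast count_add_count_not fun j => ξ j = c
    -- The supporters of `c` make up at least `1 - q - (β - q) / 2` of all nodes; losing a further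
    -- `(β - q) / 2` by sampling leaves `1 - β`, enough for every admissible threshold.
    have hx : 1 - p.β ≤ (count fun j => ξ j = c) / p.n - (p.β - p.q) / 2 := by
      rw [le_sub_iff_add_le, le_div_iff₀ hn]
      have := Params.one_sub_q_mul_n hh
      unfold Params.minority at hpre
      nlinarith
    have := E.threshold_mem_Icc hm ω
    split_ifs <;> linarith [this.1, this.2]

variable [IsProbabilityMeasure P]

section Persistence

variable (hh : 1 ≤ p.honest) (h_qβ : p.q < p.β) (h_β : p.β < 1 / 2) (h_φ : 0 < p.φ)
  {m : ℕ} (hm : 1 ≤ m) {A : Set Ω} (hA : MeasurableSet[E.pre (m + 1)] A) {c : Bool}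
  (hAc : ∀ ω ∈ A, E.Preconsensus ω m c)

include hh h_qβ h_β h_φ hm hA hAc

theorem measure_decision_ne_le (j : Fin p.honest) :
    P.real (A ∩ {ω | E.decision ω m j ≠ c}) ≤ p.ε * P.real A := by
  have hop : ∀ ξ, MeasurableSet[E.pre (m + 1)] {ω | E.opinions ω m = ξ} := fun ξ =>
    E.past_le_pre m _ (E.measurableSet_opinions_eq m ξ)
  refine measureReal_le_of_fibers (fun ξ => E.pre_le m _ (hop ξ)) fun ξ => ?_
  rcases (A ∩ {ω | E.opinions ω m = ξ}).eq_empty_or_nonempty with h | h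
  · rw [Set.inter_right_comm, h]
    simp
  · obtain ⟨x, hx, hlow⟩ :=
      E.exists_lowSample_of_preconsensus hh h_β h_φ hm hAc ξ h
    have := E.measure_inter_lowSample_le _ (v₀ := Sum.inl j) (by simp [sampler]) hx m
      (hA.inter (hop ξ)) j (s := (p.β - p.q) / 2) (by linarith)
    rw [exp_sampling_eq_ε] at this
    refine (measureReal_mono ?_).trans this
    rintro ω ⟨⟨h1, h2⟩, h3⟩
    exact ⟨⟨h1, h3⟩, hlow ω h3 j h2⟩

/-- Errors are confined to exceptional samples, which are independent across nodes and have
probability at most `ε`; the count must exceed its mean bound by `φ` per honest node to pass the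
minority. -/
theorem measure_not_prevails_le :
    P.real (A ∩ {ω | ¬ E.Prevails ω m c}) ≤
      Real.exp (-2 * (1 - p.q) * p.n * p.φ ^ 2) * P.real A := by
  have hop : ∀ ξ, MeasurableSet[E.pre (m + 1)] {ω | E.opinions ω m = ξ} := fun ξ =>
    E.past_le_pre m _ (E.measurableSet_opinions_eq m ξ)
  refine measureReal_le_of_fibers (fun ξ => E.pre_le m _ (hop ξ)) fun ξ => ?_
  rcases (A ∩ {ω | E.opinions ω m = ξ}).eq_empty_or_nonempty with h | h
  · rw [Set.inter_right_comm, h]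
    simp
  · obtain ⟨x, hx, hlow⟩ :=
      E.exists_lowSample_of_preconsensus hh h_β h_φ hm hAc ξ h
    have := E.measure_inter_count_lowSample_le _ (v₀ := Sum.inl ⟨0, hh⟩) (by simp [sampler]) hx hh m
      (hA.inter (hop ξ)) (s := (p.β - p.q) / 2) (by linarith)
      (exp_sampling_eq_ε).le h_φ.le
    rw [mul_assoc (-2) (1 - p.q), Params.one_sub_q_mul_n hh]
    refine (measureReal_mono ?_).trans this
    rintro ω ⟨⟨h1, h2⟩, h3⟩
    refine ⟨⟨h1, h3⟩, ?_⟩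
    simp only [Set.mem_ofPred_eq, Prevails, not_le] at h2 ⊢
    rw [Params.honest_mul_ε_add_φ hh]
    refine h2.le.trans ?_
    exact_mod_cast count_mono fun j hj => hlow ω h3 j hj

end Persistence

/-! ### Creation of a majority by a sound random number -/

section Jump

/-- A sample deviates by half the fringe with probability at most `(β - q) / (4 * (1 - q))`, which
is half the share of the minority among the honest nodes. The other half is the deviation allowed to
the count in `tail_spec`. -/
theorem fringe_spec (hh : 1 ≤ p.honest) (h_qβ : p.q < p.β) (h_β : p.β < 1 / 2) (h_φ : 0 < p.φ) :
    Real.exp (-2 * p.k * (p.fringe / 2) ^ 2) = (p.β - p.q) / (4 * (1 - p.q)) := by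
  have hk : (0 : ℝ) < p.k := Nat.cast_pos.2 (Params.k_pos hh h_β h_φ)
  have h1 := Params.one_sub_q_pos hh
  have h2 : 0 < p.β - p.q := by linarith
  have h3 : 1 ≤ 4 * (1 - p.q) / (p.β - p.q) := by
    rw [le_div_iff₀ h2]
    linarith
  have h4 : p.fringe ^ 2 = 2 * (p.k : ℝ)⁻¹ * Real.log (4 * (1 - p.q) / (p.β - p.q)) :=
    Real.sq_sqrt (mul_nonneg (by positivity) (Real.log_nonneg h3))
  have h5 : -2 * (p.k : ℝ) * (p.fringe / 2) ^ 2 =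
      -Real.log (4 * (1 - p.q) / (p.β - p.q)) := by
    rw [div_pow, h4]
    field_simp
  rw [h5, Real.exp_neg, Real.exp_log (by linarith), inv_div]

theorem tail_spec (hh : 1 ≤ p.honest) (h_qβ : p.q < p.β) :
    Real.exp (-2 * p.honest * ((p.β - p.q) / (4 * (1 - p.q))) ^ 2) ≤ p.tail / 2 := by
  have h1 := Params.one_sub_q_pos hh
  have hn := Params.n_pos hh
  unfold Params.tail
  rw [mul_div_cancel_left₀ _ two_ne_zero, Real.exp_le_exp, ← Params.one_sub_q_mul_n hh]
  have e : -2 * ((1 - p.q) * p.n) * ((p.β - p.q) / (4 * (1 - p.q))) ^ 2 =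
      -(1 / 8) * p.n * ((p.β - p.q) ^ 2 / (1 - p.q)) := by
    field_simp
    ring
  have h2 : (p.β - p.q) ^ 2 / (4 * (1 - p.q)) ≤ (p.β - p.q) ^ 2 / (1 - p.q) := by
    gcongr
    linarith
  rw [e]
  nlinarith

/-- If the random number is sound, some opinion is likely to prevail. -/
theorem measure_no_prevails_le (hh : 1 ≤ p.honest) (h_qβ : p.q < p.β) (h_β : p.β < 1 / 2)
    (h_φ : 0 < p.φ) {m : ℕ} (hm : 1 ≤ m) {A : Set Ω} (hA : MeasurableSet[E.pre (m + 1)] A)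
    {a : Bool → Option Bool} {bit : Ω → Fin p.adversarial → Bool}
    (hbit : ∀ v, MeasurableSet[E.pre (m + 1)] {ω | bit ω v = true})
    (hcon : E.Constrained m a bit) {D : ℝ} (hD : 0 ≤ D)
    (hfrac : ∀ (ξ : Fin p.honest → Bool) (b : Fin p.adversarial → Bool), ∃ x : Bool → ℝ,
      (∀ c, ((Finset.univ.filter fun v => sampler (p := p) a c ξ b v = some true).card : ℝ) =
        x c * (Finset.univ.filter fun v => sampler (p := p) a c ξ b v ≠ none).card) ∧
      min (1 - x false + p.fringe / 2) (1 - p.β) - max (x true - p.fringe / 2) p.β ≤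
        D * (1 - 2 * p.β)) :
    P.real (A ∩ E.good (m + 1) ∩ {ω | ∀ c, ¬ E.Prevails ω m c}) ≤
      (p.tail + D) * P.real (A ∩ E.good (m + 1)) := by
  have hq := Params.one_sub_q_pos hh
  have hop : ∀ ξ, MeasurableSet[E.pre (m + 1)] {ω | E.opinions ω m = ξ} := fun ξ =>
    E.past_le_pre m _ (E.measurableSet_opinions_eq m ξ)
  have hbit' : ∀ b, MeasurableSet[E.pre (m + 1)] {ω | bit ω = b} := fun b => by
    have : {ω | bit ω = b} = ⋂ v, {ω | bit ω v = b v} := by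
      ext ω
      simp [funext_iff]
    rw [this]
    refine MeasurableSet.iInter fun v => ?_
    rcases b v with _ | _
    · have : {ω | bit ω v = false} = {ω | bit ω v = true}ᶜ := by
        ext ω
        simp
      rw [this]
      exact (hbit v).compl
    · exact hbit v
  -- Fixing opinions and preferences makes both samplers deterministic, while the fibre stays
  -- measurable before the queries.
  have hfib : ∀ y : (Fin p.honest → Bool) × (Fin p.adversarial → Bool),
      MeasurableSet[E.pre (m + 1)] {ω | (E.opinions ω m, bit ω) = y} := fun y => by
    have : {ω | (E.opinions ω m, bit ω) = y} =
        {ω | E.opinions ω m = y.1} ∩ {ω | bit ω = y.2} := by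
      ext ω
      simp [Prod.ext_iff]
    rw [this]
    exact (hop _).inter (hbit' _)
  refine measureReal_le_of_fibers (fun y => E.pre_le m _ (hfib y)) ?_
  rintro ⟨ξ, b⟩
  obtain ⟨x, hx, hclose⟩ := hfrac ξ b
  set B : Set Ω := A ∩ E.good (m + 1) ∩ {ω | (E.opinions ω m, bit ω) = (ξ, b)} with hB
  have hBm : MeasurableSet[E.pre (m + 1)] B := (hA.inter (E.good_meas m)).inter (hfib _)
  set κ := (p.β - p.q) / (4 * (1 - p.q)) with hκ
  have hκ0 : 0 ≤ κ := div_nonneg (by linarith) (by linarith)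
  have hmin : (p.honest : ℝ) * (κ + κ) = p.minority := by
    rw [← Params.one_sub_q_mul_n hh, hκ, Params.minority]
    field_simp
    ring
  set L : Bool → Set Ω := fun c => {ω | (p.honest : ℝ) * (κ + κ) ≤
    count fun j => ω ∈ E.lowSample m (sampler a c ξ b) (x c - p.fringe / 2) j} with hL
  have hLle : ∀ c, P.real (B ∩ L c) ≤ p.tail / 2 * P.real B := fun c => by
    refine (E.measure_inter_count_lowSample_le (sampler a c ξ b) (v₀ := Sum.inl ⟨0, hh⟩)
      (by simp [sampler]) (hx c) hh m hBm (div_nonneg (Real.sqrt_nonneg _) zero_le_two)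
      (fringe_spec hh h_qβ h_β h_φ).le hκ0).trans ?_
    exact mul_le_mul_of_nonneg_right (tail_spec hh h_qβ) measureReal_nonneg
  set I := Set.Ioo (x true - p.fringe / 2) (1 - x false + p.fringe / 2) with hI
  have hTle : P.real (B ∩ E.threshold (m + 1) ⁻¹' I) ≤ D * P.real B := by
    have h := E.threshold_unif m B I (E.pre_le_mid m _ hBm) measurableSet_Ioo
    have hBg : B ∩ E.good (m + 1) = B := by
      rw [Set.inter_eq_left]
      exact fun ω hω => hω.1.2
    have hlow : p.lower (m + 1) = p.β := if_neg (by omega)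
    have hup : p.upper (m + 1) = 1 - p.β := if_neg (by omega)
    rw [hBg, hlow, hup] at h
    rw [measureReal_def, h, ENNReal.toReal_mul, mul_comm]
    exact mul_le_mul_of_nonneg_right (ENNReal.toReal_le_of_le_ofReal hD
      (unifLaw_Ioo_le h_β hclose)) measureReal_nonneg
  have hsub : A ∩ E.good (m + 1) ∩ {ω | ∀ c, ¬ E.Prevails ω m c} ∩
      {ω | (E.opinions ω m, bit ω) = (ξ, b)} ⊆
      (B ∩ L true) ∪ (B ∩ L false) ∪ (B ∩ E.threshold (m + 1) ⁻¹' I) := by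
    rintro ω ⟨⟨h1, h2⟩, h3⟩
    have hωB : ω ∈ B := ⟨h1, h3⟩
    obtain ⟨hξ, hb⟩ := Prod.ext_iff.1 h3
    simp only at hξ hb
    -- If the threshold permits `c`, every decision against `c` comes from an exceptional sample, so
    -- `c` can only fail through too many of these.
    have key : ∀ c, (if c then E.threshold (m + 1) ω else 1 - E.threshold (m + 1) ω) ≤
        x c - p.fringe / 2 → ω ∈ L c := by
      intro c hc
      have h4 := h2 c
      simp only [Prevails, not_le] at h4
      simp only [hL, Set.mem_ofPred_eq]
      rw [hmin]
      refine h4.le.trans ?_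
      exact_mod_cast count_mono fun j hj => by
        by_contra hlow
        exact hj (hcon.decision_eq (Params.k_pos hh h_β h_φ) (by rwa [hξ, hb]) hc)
    by_cases ht : E.threshold (m + 1) ω ≤ x true - p.fringe / 2
    · exact Or.inl (Or.inl ⟨hωB, key true (by simpa using ht)⟩)
    · by_cases hf : 1 - E.threshold (m + 1) ω ≤ x false - p.fringe / 2
      · exact Or.inl (Or.inr ⟨hωB, key false (by simpa using hf)⟩)
      · refine Or.inr ⟨hωB, ?_⟩
        rw [Set.mem_preimage, hI, Set.mem_Ioo]
        constructor <;> linarith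
  calc _ ≤ P.real ((B ∩ L true) ∪ (B ∩ L false) ∪ (B ∩ E.threshold (m + 1) ⁻¹' I)) :=
        measureReal_mono hsub
    _ ≤ P.real (B ∩ L true) + P.real (B ∩ L false) +
        P.real (B ∩ E.threshold (m + 1) ⁻¹' I) :=
        (measureReal_union_le _ _).trans (add_le_add_left (measureReal_union_le _ _) _)
    _ ≤ p.tail / 2 * P.real B + p.tail / 2 * P.real B + D * P.real B :=
        add_le_add (add_le_add (hLle true) (hLle false)) hTle
    _ = (p.tail + D) * P.real B := by ring

end Jump

end Execution

/-! ### Runs in a sequence of trials with conditional error bound -/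

section Runs

/-- One step of the search for a run of length `ℓ` in a binary sequence. -/
def runStep (ℓ : ℕ) (s : NodeState) (v : Bool) : NodeState :=
  if ℓ ≤ s.streak then s
  else ⟨v, if 0 < s.streak ∧ v = s.opinion then s.streak + 1 else 1⟩

/-- The current run in a binary sequence, until a run has length `ℓ`. -/
def run (ℓ : ℕ) (b : ℕ → Bool) : ℕ → NodeState
  | 0 => ⟨false, 0⟩
  | i + 1 => runStep ℓ (run ℓ b i) (b i)

theorem run_succ (ℓ : ℕ) (b : ℕ → Bool) (i : ℕ) :
    run ℓ b (i + 1) = runStep ℓ (run ℓ b i) (b i) := rfl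

theorem run_of_final {ℓ : ℕ} {b : ℕ → Bool} {i : ℕ} (h : ℓ ≤ (run ℓ b i).streak) {i' : ℕ}
    (hi : i ≤ i') : run ℓ b i' = run ℓ b i := by
  induction i', hi using Nat.le_induction with
  | base => rfl
  | succ i' _ ih => rw [run_succ, runStep, ih, if_pos h]

/-- For `t = ℓ` both alternatives say that the search is over, whatever the run at time `i` was. -/
theorem final_of_constant {ℓ : ℕ} {b : ℕ → Bool} {i : ℕ} (t : ℕ) (h : ∀ i' < t, b (i + i') = false) :
    ℓ ≤ (run ℓ b (i + t)).streak ∨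
      t ≤ (run ℓ b (i + t)).streak ∧ (0 < t → (run ℓ b (i + t)).opinion = false) := by
  induction t with
  | zero => right; simp
  | succ t ih =>
    rw [← add_assoc, run_succ, runStep]
    by_cases hf : ℓ ≤ (run ℓ b (i + t)).streak
    · left
      rwa [if_pos hf]
    · right
      rw [if_neg hf, h t (Nat.lt_succ_self t)]
      rcases ih fun i' hi' => h i' (hi'.trans (Nat.lt_succ_self t)) with h1 | ⟨h1, h2⟩
      · exact absurd h1 hf
      · refine ⟨?_, fun _ => rfl⟩
        rcases Nat.eq_zero_or_pos t with rfl | ht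
        · dsimp only
          split_ifs <;> omega
        · dsimp only
          rw [if_pos ⟨by omega, (h2 ht).symm⟩]
          omega

/-- The probability of a run of length `ℓ` of `1`'s before a run of length `ℓ` of `0`'s, in
independent trials with success probability `ε` of which the first was a success. -/
def firstRun (ε : ℝ) (ℓ : ℕ) : ℝ :=
  ε ^ (ℓ - 1) / (ε ^ (ℓ - 1) + (1 - ε) ^ (ℓ - 1) - ε ^ (ℓ - 1) * (1 - ε) ^ (ℓ - 1))

/-- The same probability, depending on the current run. -/
def runPotential (ε : ℝ) (ℓ : ℕ) (s : NodeState) : ℝ :=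
  if s.streak = 0 then firstRun ε ℓ
  else if s.opinion then
    ε ^ (ℓ - s.streak) + (1 - ε ^ (ℓ - s.streak)) * ((1 - (1 - ε) ^ (ℓ - 1)) * firstRun ε ℓ)
  else (1 - (1 - ε) ^ (ℓ - s.streak)) * firstRun ε ℓ

variable {ε : ℝ} {ℓ : ℕ}

theorem firstRun_denom_pos (h0 : 0 < ε) (h1 : ε < 1) : 0 <
    ε ^ (ℓ - 1) + (1 - ε) ^ (ℓ - 1) - ε ^ (ℓ - 1) * (1 - ε) ^ (ℓ - 1) := by
  have e1 : 0 < ε ^ (ℓ - 1) := pow_pos h0 _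
  have e2 : 0 < (1 - ε) ^ (ℓ - 1) := pow_pos (by linarith) _
  have e3 : ε ^ (ℓ - 1) ≤ 1 := pow_le_one₀ h0.le h1.le
  nlinarith

theorem firstRun_nonneg (h0 : 0 < ε) (h1 : ε < 1) : 0 ≤ firstRun ε ℓ :=
  div_nonneg (pow_nonneg h0.le _) (firstRun_denom_pos h0 h1).le

theorem firstRun_le_one (h0 : 0 < ε) (h1 : ε < 1) : firstRun ε ℓ ≤ 1 := by
  rw [firstRun, div_le_one (firstRun_denom_pos h0 h1)]
  have e2 : 0 < (1 - ε) ^ (ℓ - 1) := pow_pos (by linarith) _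
  have e3 : ε ^ (ℓ - 1) ≤ 1 := pow_le_one₀ h0.le h1.le
  nlinarith

theorem firstRun_le (h0 : 0 < ε) (h1 : ε < 1) : firstRun ε ℓ ≤ (ε / (1 - ε)) ^ (ℓ - 1) := by
  have e1 : 0 < ε ^ (ℓ - 1) := pow_pos h0 _
  have e2 : 0 < (1 - ε) ^ (ℓ - 1) := pow_pos (by linarith) _
  have e3 : (1 - ε) ^ (ℓ - 1) ≤ 1 := pow_le_one₀ (by linarith) (by linarith)
  rw [firstRun, div_pow]
  gcongr
  nlinarith

/-- After a success, either `ℓ - 1` more successes follow or a failure comes first; after that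
failure, either `ℓ - 1` more failures follow or a success restarts the situation. `firstRun` solves
this linear equation. -/
theorem firstRun_eq (h0 : 0 < ε) (h1 : ε < 1) : firstRun ε ℓ =
    ε ^ (ℓ - 1) + (1 - ε ^ (ℓ - 1)) * ((1 - (1 - ε) ^ (ℓ - 1)) * firstRun ε ℓ) := by
  have := (firstRun_denom_pos (ℓ := ℓ) h0 h1).ne'
  rw [firstRun]
  field_simp
  ring

theorem runPotential_nonneg (h0 : 0 < ε) (h1 : ε < 1) (s : NodeState) :
    0 ≤ runPotential ε ℓ s := by
  have e1 : ∀ k : ℕ, 0 ≤ ε ^ k := fun k => pow_nonneg h0.le _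
  have e2 : ∀ k : ℕ, 0 ≤ 1 - ε ^ k := fun k => sub_nonneg.2 (pow_le_one₀ h0.le h1.le)
  have e3 : ∀ k : ℕ, 0 ≤ 1 - (1 - ε) ^ k := fun k =>
    sub_nonneg.2 (pow_le_one₀ (by linarith) (by linarith))
  have e4 := firstRun_nonneg (ℓ := ℓ) h0 h1
  unfold runPotential
  split_ifs
  · exact e4
  · exact add_nonneg (e1 _) (mul_nonneg (e2 _) (mul_nonneg (e3 _) e4))
  · exact mul_nonneg (e3 _) e4

/-- The potential is a supermartingale for success probability exactly `ε`; its monotonicity in the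
outcome extends this to conditional probabilities at most `ε`. For the empty run the value
`firstRun` is merely an upper bound, as if a success had already occurred. -/
theorem runPotential_step (hℓ : 1 ≤ ℓ) (h0 : 0 < ε) (h1 : ε < 1) (s : NodeState) :
    runPotential ε ℓ (runStep ℓ s false) ≤ runPotential ε ℓ (runStep ℓ s true) ∧
    ε * runPotential ε ℓ (runStep ℓ s true) + (1 - ε) * runPotential ε ℓ (runStep ℓ s false) ≤
      runPotential ε ℓ s := by
  obtain ⟨o, k⟩ := s
  have hA0 := firstRun_nonneg (ℓ := ℓ) h0 h1
  have hA1 := firstRun_le_one (ℓ := ℓ) h0 h1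
  have hAeq := firstRun_eq (ℓ := ℓ) h0 h1
  set A := firstRun ε ℓ with hA
  set B := (1 - (1 - ε) ^ (ℓ - 1)) * A with hB
  have hq : ∀ k : ℕ, 0 ≤ (1 - ε) ^ k := fun k => pow_nonneg (by linarith) _
  have hq1 : ∀ k : ℕ, (1 - ε) ^ k ≤ 1 := fun k => pow_le_one₀ (by linarith) (by linarith)
  have hp : ∀ k : ℕ, 0 ≤ ε ^ k := fun k => pow_nonneg h0.le _
  have hBA : B ≤ A := by nlinarith [hq (ℓ - 1)]
  by_cases hk : ℓ ≤ k
  · have hs : ∀ v, runStep ℓ ⟨o, k⟩ v = ⟨o, k⟩ := fun v => if_pos hk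
    rw [hs, hs]
    exact ⟨le_rfl, by linarith⟩
  · have hs : ∀ v, runStep ℓ ⟨o, k⟩ v = ⟨v, if 0 < k ∧ v = o then k + 1 else 1⟩ :=
      fun v => if_neg hk
    have hT : runPotential ε ℓ ⟨true, 1⟩ = A := by
      simp only [runPotential, one_ne_zero, if_false, if_true]
      exact hAeq.symm
    have hF : runPotential ε ℓ ⟨false, 1⟩ = B := by
      simp [runPotential, hB, hA]
    have hle : ε * A + (1 - ε) * B ≤ A := by nlinarith
    rw [hs, hs]
    rcases Nat.eq_zero_or_pos k with rfl | hk0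
    · simp only [lt_irrefl, false_and, if_false]
      rw [hT, hF]
      exact ⟨hBA, by simpa [runPotential] using hle⟩
    · obtain ⟨d, rfl⟩ : ∃ d, ℓ = k + 1 + d := ⟨ℓ - (k + 1), by omega⟩
      have d1 : k + 1 + d - (k + 1) = d := by omega
      have d2 : k + 1 + d - k = d + 1 := by omega
      cases o
      · simp only [Bool.true_eq_false, and_false, if_false, and_true, if_pos hk0]
        rw [hT]
        have e1 : runPotential ε (k + 1 + d) ⟨false, k + 1⟩ = (1 - (1 - ε) ^ d) * A := by
          simp [runPotential, d1, hA]
        have e2 : runPotential ε (k + 1 + d) ⟨false, k⟩ = (1 - (1 - ε) ^ (d + 1)) * A := by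
          simp [runPotential, d2, hA, hk0.ne']
        rw [e1, e2, pow_succ]
        constructor
        · nlinarith [hq d]
        · exact le_of_eq (by ring)
      · simp only [Bool.false_eq_true, and_false, if_false, and_true, if_pos hk0]
        rw [hF]
        have e1 : runPotential ε (k + 1 + d) ⟨true, k + 1⟩ = ε ^ d + (1 - ε ^ d) * B := by
          simp [runPotential, d1, hA, hB]
        have e2 : runPotential ε (k + 1 + d) ⟨true, k⟩ =
            ε ^ (d + 1) + (1 - ε ^ (d + 1)) * B := by
          simp [runPotential, d2, hA, hB, hk0.ne']
        rw [e1, e2, pow_succ]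
        constructor
        · nlinarith [hp d]
        · exact le_of_eq (by ring)

variable {Ω : Type*} {F : ℕ → MeasurableSpace Ω} {B : ℕ → Set Ω}

open Classical in
/-- The run in the sequence of indicators of the events `B i`. -/
def runOf (ℓ : ℕ) (B : ℕ → Set Ω) (i : ℕ) (ω : Ω) : NodeState :=
  run ℓ (fun i => decide (ω ∈ B i)) i

open Classical in
theorem runOf_succ (ω : Ω) (i : ℕ) :
    runOf ℓ B (i + 1) ω = runStep ℓ (runOf ℓ B i ω) (decide (ω ∈ B i)) := rfl

theorem measurableSet_runOf (hF : Monotone F) (hB : ∀ i, MeasurableSet[F (i + 1)] (B i)) (i : ℕ)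
    (s : NodeState) : MeasurableSet[F i] {ω | runOf ℓ B i ω = s} := by
  induction i generalizing s with
  | zero => exact MeasurableSet.const ((⟨false, 0⟩ : NodeState) = s)
  | succ i ih =>
    have : {ω | runOf ℓ B (i + 1) ω = s} =
        (⋃ x : {x // runStep ℓ x true = s}, {ω | runOf ℓ B i ω = x} ∩ B i) ∪
        (⋃ x : {x // runStep ℓ x false = s}, {ω | runOf ℓ B i ω = x} ∩ (B i)ᶜ) := by
      ext ω
      simp only [Set.mem_ofPred_eq, Set.mem_union, Set.mem_iUnion, Set.mem_inter_iff, runOf_succ,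
        Set.mem_compl_iff]
      by_cases h : ω ∈ B i
      · simp [h]
      · simp [h]
    rw [this]
    have hF' := hF (Nat.le_succ i)
    exact (MeasurableSet.iUnion fun x => (hF' _ (ih _)).inter (hB i)).union
      (MeasurableSet.iUnion fun x => (hF' _ (ih _)).inter (hB i).compl)

variable [mΩ : MeasurableSpace Ω] {P : Measure Ω} [IsProbabilityMeasure P]

/-- Induction on the number `T` of remaining trials. Conditioning is expressed through events `A` on
which the current run is constant, split according to the next trial. -/
theorem measure_final_true_le (hF : Monotone F) (hFle : ∀ i, F i ≤ mΩ)
    (hB : ∀ i, MeasurableSet[F (i + 1)] (B i)) (hℓ : 1 ≤ ℓ) (h0 : 0 < ε) (h1 : ε < 1)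
    (hε : ∀ i A, MeasurableSet[F i] A → P.real (A ∩ B i) ≤ ε * P.real A) (T : ℕ) :
    ∀ i s A, MeasurableSet[F i] A → (∀ ω ∈ A, runOf ℓ B i ω = s) →
      P.real (A ∩ {ω | ℓ ≤ (runOf ℓ B (i + T) ω).streak ∧ (runOf ℓ B (i + T) ω).opinion = true}) ≤
        runPotential ε ℓ s * P.real A := by
  induction T with
  | zero =>
    intro i s A hA hs
    by_cases hfin : ℓ ≤ s.streak ∧ s.opinion = true
    · have : runPotential ε ℓ s = 1 := by
        have h2 : ℓ - s.streak = 0 := by omega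
        simp only [runPotential, h2, hfin.2, if_true, pow_zero, sub_self, zero_mul, add_zero]
        rw [if_neg (by omega)]
      rw [this, one_mul]
      exact measureReal_mono Set.inter_subset_left
    · have : A ∩ {ω | ℓ ≤ (runOf ℓ B (i + 0) ω).streak ∧
          (runOf ℓ B (i + 0) ω).opinion = true} = ∅ := by
        ext ω
        simp only [add_zero, Set.mem_inter_iff, Set.mem_ofPred_eq, Set.mem_empty_iff_false, iff_false,
          not_and]
        intro hω h3 h4
        rw [hs ω hω] at h3 h4
        exact hfin ⟨h3, h4⟩
      rw [this, measureReal_empty]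
      exact mul_nonneg (runPotential_nonneg h0 h1 s) measureReal_nonneg
  | succ T ih =>
    intro i s A hA hs
    have hA' := hF (Nat.le_succ i) _ hA
    obtain ⟨hst, hpot⟩ := runPotential_step hℓ h0 h1 s
    have ht := ih (i + 1) (runStep ℓ s true) (A ∩ B i) (hA'.inter (hB i)) fun ω hω => by
      rw [runOf_succ, hs ω hω.1]
      simp [hω.2]
    have hf := ih (i + 1) (runStep ℓ s false) (A \ B i) (hA'.diff (hB i)) fun ω hω => by
      rw [runOf_succ, hs ω hω.1]
      simp [hω.2]
    rw [show i + 1 + T = i + (T + 1) by ring] at ht hf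
    set w := {ω | ℓ ≤ (runOf ℓ B (i + (T + 1)) ω).streak ∧
      (runOf ℓ B (i + (T + 1)) ω).opinion = true}
    have hsplit : P.real (A ∩ w) ≤ P.real (A ∩ B i ∩ w) + P.real (A \ B i ∩ w) := by
      refine (measureReal_mono ?_).trans (measureReal_union_le _ _)
      rintro ω ⟨h2, h3⟩
      by_cases h4 : ω ∈ B i
      · exact Or.inl ⟨⟨h2, h4⟩, h3⟩
      · exact Or.inr ⟨⟨h2, h4⟩, h3⟩
    have hdiff : P.real (A ∩ B i) + P.real (A \ B i) = P.real A :=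
      measureReal_inter_add_sdiff (hFle _ _ (hB i))
    have hb := hε i A hA
    have hPA : 0 ≤ P.real A := measureReal_nonneg
    have e1 := mul_nonneg (sub_nonneg.2 hst) (sub_nonneg.2 hb)
    have e2 := mul_le_mul_of_nonneg_right hpot hPA
    rw [← eq_sub_iff_add_eq'] at hdiff
    rw [hdiff] at hf
    linarith

theorem measure_not_final_le (hF : Monotone F) (hFle : ∀ i, F i ≤ mΩ)
    (hB : ∀ i, MeasurableSet[F (i + 1)] (B i)) (h0 : 0 < ε) (h1 : ε < 1)
    (hε : ∀ i A, MeasurableSet[F i] A → P.real (A ∩ B i) ≤ ε * P.real A) (u : ℕ) :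
    P.real {ω | ¬ ℓ ≤ (runOf ℓ B (ℓ * u) ω).streak} ≤ (1 - (1 - ε) ^ ℓ) ^ u := by
  induction u with
  | zero => simp
  | succ u ih =>
    set U := {ω | ¬ ℓ ≤ (runOf ℓ B (ℓ * u) ω).streak} with hU
    have hUm : MeasurableSet[F (ℓ * u)] U := by
      have : U = ⋃ s : {s : NodeState // ¬ ℓ ≤ s.streak}, {ω | runOf ℓ B (ℓ * u) ω = s} := by
        ext ω
        simp only [hU, Set.mem_ofPred_eq, Set.mem_iUnion]
        exact ⟨fun h => ⟨⟨_, h⟩, rfl⟩, fun ⟨⟨s, hs⟩, h⟩ => h ▸ hs⟩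
      rw [this]
      exact MeasurableSet.iUnion fun s => measurableSet_runOf hF hB _ _
    -- If the search is unfinished after `u` blocks, the next block is free of adversities, and so
    -- ends the search, with conditional probability at least `(1 - ε) ^ ℓ`.
    have key : ∀ t : ℕ, MeasurableSet[F (ℓ * u + t)] (U ∩ {ω | ∀ i < t, ω ∉ B (ℓ * u + i)}) ∧
        (1 - ε) ^ t * P.real U ≤ P.real (U ∩ {ω | ∀ i < t, ω ∉ B (ℓ * u + i)}) := by
      intro t
      induction t with
      | zero => simpa using hUm
      | succ t iht =>
        obtain ⟨hm, hle⟩ := iht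
        set V := U ∩ {ω | ∀ i < t, ω ∉ B (ℓ * u + i)} with hV
        have hVs : U ∩ {ω | ∀ i < t + 1, ω ∉ B (ℓ * u + i)} = V \ B (ℓ * u + t) := by
          ext ω
          simp only [hV, Set.mem_inter_iff, Set.mem_ofPred_eq, Set.mem_sdiff, Nat.lt_succ_iff_lt_or_eq,
            or_imp, forall_and, forall_eq, and_assoc]
        rw [hVs]
        refine ⟨(hF (Nat.le_succ _) _ hm).diff (hB _), ?_⟩
        have hd : P.real (V ∩ B (ℓ * u + t)) + P.real (V \ B (ℓ * u + t)) = P.real V :=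
          measureReal_inter_add_sdiff (hFle _ _ (hB _))
        have hb := hε _ V hm
        rw [pow_succ]
        nlinarith
    obtain ⟨hm, hle⟩ := key ℓ
    set V := U ∩ {ω | ∀ i < ℓ, ω ∉ B (ℓ * u + i)} with hV
    have hsub : {ω | ¬ ℓ ≤ (runOf ℓ B (ℓ * (u + 1)) ω).streak} ⊆ U \ V := by
      intro ω hω
      rw [mul_add, mul_one] at hω
      have hωU : ω ∈ U := fun h => hω (by
        unfold runOf at h ⊢
        rwa [run_of_final h (Nat.le_add_right _ _)])
      refine ⟨hωU, fun hωV => hω ?_⟩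
      have := final_of_constant (ℓ := ℓ) (b := fun i => @decide (ω ∈ B i) (Classical.propDecidable _))
        (i := ℓ * u) ℓ fun i hi => by simpa using hωV.2 i hi
      exact this.elim id fun h => h.1
    have hd : P.real V + P.real (U \ V) = P.real U := by
      have := measureReal_inter_add_sdiff (μ := P) (s := U) (hFle _ _ hm)
      rwa [Set.inter_eq_self_of_subset_right Set.inter_subset_left] at this
    have hc : 0 ≤ 1 - (1 - ε) ^ ℓ := sub_nonneg.2 (pow_le_one₀ (by linarith) (by linarith))
    calc _ ≤ P.real (U \ V) := measureReal_mono hsub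
      _ ≤ (1 - (1 - ε) ^ ℓ) * P.real U := by linarith
      _ ≤ (1 - (1 - ε) ^ ℓ) * (1 - (1 - ε) ^ ℓ) ^ u := mul_le_mul_of_nonneg_left ih hc
      _ = (1 - (1 - ε) ^ ℓ) ^ (u + 1) := by ring

/-- If adversities have conditional probability at most `ε`, then in `u` blocks of length `ℓ` a run
of `ℓ` steps without adversity is likely to occur before a run of `ℓ` adversities. -/
theorem measure_not_final_false_le (hF : Monotone F) (hFle : ∀ i, F i ≤ mΩ)
    (hB : ∀ i, MeasurableSet[F (i + 1)] (B i)) (hℓ : 1 ≤ ℓ) (h0 : 0 < ε) (h1 : ε < 1)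
    (hε : ∀ i A, MeasurableSet[F i] A → P.real (A ∩ B i) ≤ ε * P.real A) (u : ℕ) :
    P.real {ω | ¬ (ℓ ≤ (runOf ℓ B (ℓ * u) ω).streak ∧ (runOf ℓ B (ℓ * u) ω).opinion = false)} ≤
      (1 - (1 - ε) ^ ℓ) ^ u + (ε / (1 - ε)) ^ (ℓ - 1) := by
  have ht := measure_final_true_le hF hFle hB hℓ h0 h1 hε (ℓ * u) 0 ⟨false, 0⟩ Set.univ
    MeasurableSet.univ fun ω _ => rfl
  have hn := measure_not_final_le (ℓ := ℓ) hF hFle hB h0 h1 hε u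
  simp only [Set.univ_inter, zero_add, probReal_univ, mul_one] at ht
  have hp : runPotential ε ℓ ⟨false, 0⟩ = firstRun ε ℓ := rfl
  rw [hp] at ht
  refine (measureReal_mono ?_).trans ((measureReal_union_le _ _).trans
    (add_le_add hn (ht.trans (firstRun_le h0 h1))))
  intro ω hω
  by_cases h : ℓ ≤ (runOf ℓ B (ℓ * u) ω).streak
  · right
    refine ⟨h, ?_⟩
    by_contra h'
    exact hω ⟨h, by simpa using h'⟩
  · exact Or.inl h

end Runs

/-! ### From a consolidated majority to final opinions -/

namespace Execution

variable {p : Params} {θ : ℝ} {Ω : Type*} [mΩ : MeasurableSpace Ω] {P : Measure Ω}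
  (E : Execution p θ P)

theorem streak_eq_zero {m : ℕ} (hm : m ≤ p.m₀) (ω : Ω) (j : Fin p.honest) (hℓ : 1 ≤ p.ℓ) :
    (E.state ω m j).streak = 0 := by
  induction m with
  | zero => rfl
  | succ m ih =>
    rw [state_succ, NodeState.step, ih (by omega), if_neg (by omega)]
    exact if_pos hm

theorem opinions_succ_of_not_final {ω : Ω} {m : ℕ} {j : Fin p.honest}
    (h : (E.state ω m j).streak < p.ℓ) : E.opinions ω (m + 1) j = E.decision ω m j := by
  rw [opinions, state_succ, NodeState.step, if_neg (not_le.2 h)]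

theorem opinions_succ_of_final {ω : Ω} {m : ℕ} {j : Fin p.honest}
    (h : p.ℓ ≤ (E.state ω m j).streak) : E.opinions ω (m + 1) j = E.opinions ω m j := by
  rw [opinions, state_succ, NodeState.step, if_pos h, opinions]

/-- Before the first counted round, the opinions are the latest decisions. -/
theorem preconsensus_succ_of_lt {m : ℕ} (hm : m < p.m₀) (hℓ : 1 ≤ p.ℓ) {ω : Ω} {c : Bool}
    (h : E.Prevails ω m c) : E.Preconsensus ω (m + 1) c := by
  have : ∀ j, E.opinions ω (m + 1) j = E.decision ω m j := fun j =>
    E.opinions_succ_of_not_final (by rw [E.streak_eq_zero hm.le ω j hℓ]; omega)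
  simpa only [Preconsensus, Prevails, this] using h

/-- No opinion prevails in any of the rounds `2, …, i + 1`. -/
def neverPrevails (i : ℕ) : Set Ω := {ω | ∀ i' < i, ∀ c, ¬ E.Prevails ω (i' + 1) c}

theorem measurableSet_neverPrevails (i : ℕ) :
    MeasurableSet[E.past (i + 1)] (E.neverPrevails i) := by
  have : E.neverPrevails i = ⋂ i' : Fin i, ⋂ c, {ω | E.Prevails ω (i' + 1) c}ᶜ := by
    ext ω
    simp only [neverPrevails, Set.mem_ofPred_eq, Set.mem_iInter, Set.mem_compl_iff]
    exact ⟨fun h i' c => h i' i'.2 c, fun h i' hi' c => h ⟨i', hi'⟩ c⟩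
  rw [this]
  exact MeasurableSet.iInter fun i' => MeasurableSet.iInter fun c =>
    (E.past_mono (by omega) _ (E.measurableSet_prevails (i' + 1) c)).compl

/-- A majority is lost in round `m + 1`. -/
def relapse (m : ℕ) : Set Ω := {ω | ∃ c, E.Preconsensus ω m c ∧ ¬ E.Prevails ω m c}

/-- From round `m₀` on to round `m₀ + i`, the majority has the opinion `c`. -/
def Consolidated (ω : Ω) (i : ℕ) (c : Bool) : Prop := ∀ i' ≤ i, E.Preconsensus ω (p.m₀ + i') c

theorem measurableSet_consolidated (i : ℕ) (c : Bool) :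
    MeasurableSet[E.past (p.m₀ + i)] {ω | E.Consolidated ω i c} := by
  have : {ω | E.Consolidated ω i c} =
      ⋂ i' : Fin (i + 1), {ω | E.Preconsensus ω (p.m₀ + i') c} := by
    ext ω
    simp only [Consolidated, Set.mem_ofPred_eq, Set.mem_iInter]
    exact ⟨fun h i' => h i' (by omega), fun h i' hi' => h ⟨i', by omega⟩⟩
  rw [this]
  exact MeasurableSet.iInter fun i' =>
    E.past_mono (by omega) _ (E.measurableSet_preconsensus (p.m₀ + i') c)

/-- The node `j` decides against a consolidated majority in round `m₀ + i + 1`. -/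
def adversity (j : Fin p.honest) (i : ℕ) : Set Ω :=
  {ω | ∃ c, E.Consolidated ω i c ∧ E.decision ω (p.m₀ + i) j ≠ c}

theorem measurableSet_adversity (j : Fin p.honest) (i : ℕ) :
    MeasurableSet[E.past (p.m₀ + (i + 1))] (E.adversity j i) := by
  have : E.adversity j i =
      ⋃ c, {ω | E.Consolidated ω i c} ∩ {ω | E.decision ω (p.m₀ + i) j ≠ c} := by
    ext ω
    simp [adversity]
  rw [this]
  exact MeasurableSet.iUnion fun c =>
    (E.past_mono (Nat.le_succ _) _ (E.measurableSet_consolidated i c)).inter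
      (E.measurableSet_decision_ne (p.m₀ + i) j c)

/-- The deterministic part: without relapses, a majority makes the nodes final which have
sufficiently few adversities. -/
theorem final_of_consolidated (hh : 1 ≤ p.honest) (h_m₀ : 1 ≤ p.m₀) (h_ℓ : 1 ≤ p.ℓ)
    (h_β : p.β < 1 / 2) {ω : Ω} {c : Bool} (hc : E.Preconsensus ω p.m₀ c) {T : ℕ}
    (hrel : ∀ m, 1 ≤ m → m < p.m₀ + T → ω ∉ E.relapse m)
    (hfin : ∀ j, p.ℓ ≤ (runOf p.ℓ (E.adversity j) T ω).streak ∧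
      (runOf p.ℓ (E.adversity j) T ω).opinion = false) (j : Fin p.honest) :
    p.ℓ ≤ (E.state ω (p.m₀ + T) j).streak ∧ (E.state ω (p.m₀ + T) j).opinion = c := by
  have key : ∀ i ≤ T, E.Consolidated ω i c ∧ ∀ j,
      (E.state ω (p.m₀ + i) j).streak = (runOf p.ℓ (E.adversity j) i ω).streak ∧
      (0 < (E.state ω (p.m₀ + i) j).streak → ((E.state ω (p.m₀ + i) j).opinion = c ↔
        (runOf p.ℓ (E.adversity j) i ω).opinion = false)) := by
    intro i
    induction i with
    | zero =>
      intro _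
      refine ⟨fun i' hi' => by rwa [Nat.le_zero.1 hi'], fun j => ?_⟩
      have := E.streak_eq_zero (m := p.m₀) le_rfl ω j h_ℓ
      rw [add_zero, this]
      exact ⟨rfl, fun h => absurd h (lt_irrefl 0)⟩
    | succ i ih =>
      intro hi
      obtain ⟨hcons, hst⟩ := ih (by omega)
      have hadv : ∀ j, ω ∈ E.adversity j i ↔ E.decision ω (p.m₀ + i) j ≠ c := fun j => by
        refine ⟨fun ⟨c', h1, h2⟩ => ?_, fun h => ⟨c, hcons, h⟩⟩
        rwa [E.preconsensus_unique hh h_β (h1 0 (Nat.zero_le _)) (hcons 0 (Nat.zero_le _))] at h2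
      have hprev : E.Prevails ω (p.m₀ + i) c := by
        by_contra h
        exact hrel (p.m₀ + i) (by omega) (by omega) ⟨c, hcons i le_rfl, h⟩
      refine ⟨fun i' hi' => ?_, fun j => ?_⟩
      · rcases Nat.lt_or_ge i' (i + 1) with h | h
        · exact hcons i' (by omega)
        · obtain rfl : i' = i + 1 := by omega
          refine le_trans ?_ hprev
          exact_mod_cast count_mono fun j hj => by
            by_cases hf : p.ℓ ≤ (E.state ω (p.m₀ + i) j).streak
            · exfalso
              -- A finalized node no longer follows its decisions. As its run is frozen, `hfin` at
              -- time `T` shows that it finalized `c`, so it does not swell the minority.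
              refine hj ((E.opinions_succ_of_final hf).trans ?_)
              refine ((hst j).2 (by omega)).2 ?_
              have h1 : p.ℓ ≤ (runOf p.ℓ (E.adversity j) i ω).streak := (hst j).1 ▸ hf
              have h2 := (hfin j).2
              unfold runOf at h1 h2 ⊢
              rwa [run_of_final h1 (by omega : i ≤ T)] at h2
            · rwa [← E.opinions_succ_of_not_final (not_le.1 hf)]
      · obtain ⟨h1, h2⟩ := hst j
        rw [← add_assoc, state_succ, runOf_succ, NodeState.step, runStep, ← h1]
        by_cases hf : p.ℓ ≤ (E.state ω (p.m₀ + i) j).streak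
        · rw [if_pos hf, if_pos hf]
          exact ⟨h1, h2⟩
        · rw [if_neg hf, if_neg hf]
          have hm : ¬ p.m₀ + i + 1 ≤ p.m₀ := by omega
          simp only [hm, if_false, hadv j]
          constructor
          · by_cases hs : 0 < (E.state ω (p.m₀ + i) j).streak
            · have := h2 hs
              congr 1
              simp only [hs, true_and, eq_iff_iff]
              revert this
              cases E.decision ω (p.m₀ + i) j <;> cases c <;>
                cases (E.state ω (p.m₀ + i) j).opinion <;>
                cases (runOf p.ℓ (E.adversity j) i ω).opinion <;> simp
            · simp [hs]
          · intro _
            simp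
  obtain ⟨-, hst⟩ := key T le_rfl
  obtain ⟨h1, h2⟩ := hst j
  have h3 : p.ℓ ≤ (E.state ω (p.m₀ + T) j).streak := h1 ▸ (hfin j).1
  exact ⟨h3, (h2 (by omega)).2 (hfin j).2⟩

/-! ### Probability bounds for the whole execution -/

variable [IsProbabilityMeasure P]

theorem measureReal_add_preconsensus_le (hh : 1 ≤ p.honest) (h_β : p.β < 1 / 2) (A : Set Ω)
    {S : Bool → Set Ω} (hS : ∀ c, MeasurableSet (S c)) {m : ℕ}
    (hSc : ∀ c, ∀ ω ∈ S c, E.Preconsensus ω m c) :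
    P.real (A ∩ S true) + P.real (A ∩ S false) ≤ P.real A := by
  have hd : Disjoint (S true) (S false) := Set.disjoint_left.2 fun ω h1 h2 =>
    absurd (E.preconsensus_unique hh h_β (hSc _ ω h1) (hSc _ ω h2)) (by simp)
  have h1 : P.real (A ∩ S true) + P.real (A \ S true) = P.real A :=
    measureReal_inter_add_sdiff (hS true)
  have h2 : P.real (A ∩ S false) ≤ P.real (A \ S true) :=
    measureReal_mono fun ω hω => ⟨hω.1, Set.disjoint_right.1 hd hω.2⟩
  linarith

theorem measure_relapse_le (hh : 1 ≤ p.honest) (h_qβ : p.q < p.β) (h_β : p.β < 1 / 2)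
    (h_φ : 0 < p.φ) {m : ℕ} (hm : 1 ≤ m) :
    P.real (E.relapse m) ≤ Real.exp (-2 * (1 - p.q) * p.n * p.φ ^ 2) := by
  set e := Real.exp (-2 * (1 - p.q) * p.n * p.φ ^ 2) with he
  set S : Bool → Set Ω := fun c => {ω | E.Preconsensus ω m c} with hS
  have hle : ∀ c, P.real (S c ∩ {ω | ¬ E.Prevails ω m c}) ≤ e * P.real (S c) := fun c =>
    E.measure_not_prevails_le hh h_qβ h_β h_φ hm
      (E.past_le_pre m _ (E.measurableSet_preconsensus m c)) fun ω h => h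
  have hsum := E.measureReal_add_preconsensus_le hh h_β Set.univ (S := S)
    (fun c => E.past_le m _ (E.measurableSet_preconsensus m c)) fun c ω h => h
  simp only [Set.univ_inter, probReal_univ] at hsum
  have hsub : E.relapse m ⊆ (S true ∩ {ω | ¬ E.Prevails ω m true}) ∪
      (S false ∩ {ω | ¬ E.Prevails ω m false}) := by
    rintro ω ⟨_ | _, h⟩
    · exact Or.inr h
    · exact Or.inl h
  have he0 : 0 ≤ e := (Real.exp_pos _).le
  calc _ ≤ _ := measureReal_mono hsub
    _ ≤ _ := measureReal_union_le _ _
    _ ≤ e * P.real (S true) + e * P.real (S false) := add_le_add (hle true) (hle false)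
    _ ≤ e := by nlinarith

/-- An adversity presupposes a consolidated majority, so the bound holds given any past, even one
without a majority. This is what the run estimates require. -/
theorem measure_inter_adversity_le (hh : 1 ≤ p.honest) (h_m₀ : 1 ≤ p.m₀) (h_qβ : p.q < p.β)
    (h_β : p.β < 1 / 2) (h_φ : 0 < p.φ) (j : Fin p.honest) (i : ℕ) (A : Set Ω)
    (hA : MeasurableSet[E.past (p.m₀ + i)] A) :
    P.real (A ∩ E.adversity j i) ≤ p.ε * P.real A := by
  set S : Bool → Set Ω := fun c => {ω | E.Consolidated ω i c} with hS
  have hle : ∀ c, P.real (A ∩ S c ∩ {ω | E.decision ω (p.m₀ + i) j ≠ c}) ≤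
      p.ε * P.real (A ∩ S c) := fun c =>
    E.measure_decision_ne_le hh h_qβ h_β h_φ (by omega)
      (E.past_le_pre _ _ (hA.inter (E.measurableSet_consolidated i c)))
      (fun ω h => h.2 i le_rfl) j
  have hsum := E.measureReal_add_preconsensus_le hh h_β A (S := S)
    (fun c => E.past_le _ _ (E.measurableSet_consolidated i c)) fun c ω h => h i le_rfl
  have hsub : A ∩ E.adversity j i ⊆
      (A ∩ S true ∩ {ω | E.decision ω (p.m₀ + i) j ≠ true}) ∪
      (A ∩ S false ∩ {ω | E.decision ω (p.m₀ + i) j ≠ false}) := by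
    rintro ω ⟨h1, _ | _, h2, h3⟩
    · exact Or.inr ⟨⟨h1, h2⟩, h3⟩
    · exact Or.inl ⟨⟨h1, h2⟩, h3⟩
  have he0 : 0 ≤ p.ε := Params.ε_pos.le
  calc _ ≤ _ := measureReal_mono hsub
    _ ≤ _ := measureReal_union_le _ _
    _ ≤ p.ε * P.real (A ∩ S true) + p.ε * P.real (A ∩ S false) := add_le_add (hle true) (hle false)
    _ ≤ p.ε * P.real A := by nlinarith

theorem measure_neverPrevails_le {ψ : ℝ} (hψ : ψ ≤ 1) (h_θ' : θ < 1) (hψ0 : 0 ≤ ψ)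
    (hjump : ∀ m, 1 ≤ m → ∀ A, MeasurableSet[E.past m] A →
      P.real (A ∩ E.good (m + 1) ∩ {ω | ∀ c, ¬ E.Prevails ω m c}) ≤
        ψ * P.real (A ∩ E.good (m + 1))) (i : ℕ) :
    P.real (E.neverPrevails i) ≤ (1 - θ + θ * ψ) ^ i := by
  induction i with
  | zero => simp
  | succ i ih =>
    set N := E.neverPrevails i with hN
    have hNm := E.measurableSet_neverPrevails i
    have hg := E.good_prob (i + 1) N hNm
    have hj := hjump (i + 1) (by omega) N hNm
    have hd : P.real (N ∩ E.good (i + 1 + 1)) + P.real (N \ E.good (i + 1 + 1)) = P.real N :=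
      measureReal_inter_add_sdiff (E.pre_le _ _ (E.good_meas (i + 1)))
    have hsub : E.neverPrevails (i + 1) ⊆ (N \ E.good (i + 1 + 1)) ∪
        (N ∩ E.good (i + 1 + 1) ∩ {ω | ∀ c, ¬ E.Prevails ω (i + 1) c}) := by
      intro ω hω
      have h1 : ω ∈ N := fun i' hi' => hω i' (by omega)
      by_cases h2 : ω ∈ E.good (i + 1 + 1)
      · exact Or.inr ⟨⟨h1, h2⟩, hω i (Nat.lt_succ_self i)⟩
      · exact Or.inl ⟨h1, h2⟩
    have hle := (measureReal_mono (μ := P) hsub).trans (measureReal_union_le _ _)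
    -- For `ψ ≤ 1` the bound `P(N \ G) + ψ P(N ∩ G)` decreases in `P(N ∩ G)`, which is at least `θ
    -- P(N)`.
    have e1 := mul_nonneg (sub_nonneg.2 hψ) (sub_nonneg.2 hg)
    have e2 : 0 ≤ 1 - θ + θ * ψ := by nlinarith
    calc _ ≤ (1 - θ + θ * ψ) * P.real N := by linarith
      _ ≤ (1 - θ + θ * ψ) * (1 - θ + θ * ψ) ^ i := mul_le_mul_of_nonneg_left ih e2
      _ = (1 - θ + θ * ψ) ^ (i + 1) := by ring

/-- Consensus is likely if in each sound round some opinion is likely to prevail. -/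
theorem consensus_of_prevails (hh : 1 ≤ p.honest) (h_m₀ : 1 ≤ p.m₀) (h_ℓ : 1 ≤ p.ℓ)
    (h_qβ : p.q < p.β) (h_β : p.β < 1 / 2) (h_φ : 0 < p.φ) (h_θ : 0 < θ) (h_θ' : θ < 1)
    {ψ : ℝ} (hψ0 : 0 ≤ ψ)
    (hjump : ∀ m, 1 ≤ m → ∀ A, MeasurableSet[E.past m] A →
      P.real (A ∩ E.good (m + 1) ∩ {ω | ∀ c, ¬ E.Prevails ω m c}) ≤
        ψ * P.real (A ∩ E.good (m + 1))) (u : ℕ) :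
    1 - p.W u - (1 - θ + θ * ψ) ^ (p.m₀ - 1) ≤
      P.real ((E.allFinal false ∪ E.allFinal true) ∩
        {ω | E.numRounds ω ≤ ((p.m₀ + p.ℓ * u : ℕ) : ℕ∞)}) := by
  set H := (E.allFinal false ∪ E.allFinal true) ∩
    {ω | E.numRounds ω ≤ ((p.m₀ + p.ℓ * u : ℕ) : ℕ∞)} with hH
  have hε0 : 0 < p.ε := Params.ε_pos
  have hε1 : p.ε < 1 := (Params.ε_lt_half hh h_β h_φ).trans (by norm_num)
  set e := Real.exp (-2 * (1 - p.q) * p.n * p.φ ^ 2) with he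
  set w := (1 - (1 - p.ε) ^ p.ℓ) ^ u + (p.ε / (1 - p.ε)) ^ (p.ℓ - 1) with hw
  have he0 : 0 ≤ e := (Real.exp_pos _).le
  have hw0 : 0 ≤ w := add_nonneg
    (pow_nonneg (sub_nonneg.2 (pow_le_one₀ (by linarith) (by linarith))) _)
    (pow_nonneg (div_nonneg hε0.le (by linarith)) _)
  have hW : p.W u = p.honest * w + ((p.m₀ + p.ℓ * u : ℕ) : ℝ) * e := by
    unfold Params.W
    rw [Params.one_sub_q_mul_n hh]
    push_cast
    rfl
  rw [hW]
  rcases le_or_gt 1 ψ with hψ | hψ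
  -- For `ψ ≥ 1` the lower bound claimed is at most 0.
  · have h1 : 1 ≤ (1 - θ + θ * ψ) ^ (p.m₀ - 1) := one_le_pow₀ (by nlinarith)
    have h2 : 0 ≤ P.real H := measureReal_nonneg
    have h3 : (0 : ℝ) ≤ p.honest * w + ((p.m₀ + p.ℓ * u : ℕ) : ℝ) * e := by positivity
    linarith
  · set T := p.ℓ * u with hT
    set fail : Fin p.honest → Set Ω := fun j =>
      {ω | ¬ (p.ℓ ≤ (runOf p.ℓ (E.adversity j) T ω).streak ∧
        (runOf p.ℓ (E.adversity j) T ω).opinion = false)} with hfail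
    have hfailP : ∀ j, P.real (fail j) ≤ w := fun j =>
      measure_not_final_false_le (P := P) (F := fun i => E.past (p.m₀ + i))
        (fun i i' h => E.past_mono (by omega)) (fun i => E.past_le _)
        (E.measurableSet_adversity j) h_ℓ hε0 hε1
        (E.measure_inter_adversity_le hh h_m₀ h_qβ h_β h_φ j) u
    have hN := E.measure_neverPrevails_le hψ.le h_θ' hψ0 hjump (p.m₀ - 1)
    set R : Set Ω := ⋃ m ∈ Finset.Ico 1 (p.m₀ + T), E.relapse m with hR
    have hRP : P.real R ≤ ((p.m₀ + T : ℕ) : ℝ) * e := by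
      refine (measureReal_biUnion_finset_le _ _).trans ?_
      refine (Finset.sum_le_card_nsmul _ _ e fun m hm =>
        E.measure_relapse_le hh h_qβ h_β h_φ (Finset.mem_Ico.1 hm).1).trans ?_
      rw [Nat.card_Ico, nsmul_eq_mul]
      refine mul_le_mul_of_nonneg_right ?_ he0
      exact_mod_cast Nat.sub_le _ _
    have hFP : P.real (⋃ j, fail j) ≤ p.honest * w := by
      refine (measureReal_iUnion_fintype_le _).trans ?_
      refine (Finset.sum_le_card_nsmul _ _ w fun j _ => hfailP j).trans (le_of_eq ?_)
      simp
    have hcover : (Set.univ : Set Ω) ⊆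
        H ∪ (E.neverPrevails (p.m₀ - 1) ∪ (R ∪ ⋃ j, fail j)) := by
      intro ω _
      by_contra hω
      simp only [Set.mem_union, not_or, hR, Set.mem_iUnion, not_exists, Finset.mem_Ico] at hω
      obtain ⟨hωH, hωN, hωR, hωF⟩ := hω
      have hrel : ∀ m, 1 ≤ m → m < p.m₀ + T → ω ∉ E.relapse m := fun m h1 h2 => hωR m ⟨h1, h2⟩
      -- Index `m` refers to round `m + 1`, so these are the rounds 2, …, `m₀`. The majority created
      -- there survives until round `m₀` in the absence of relapses.
      have hstart : ∃ m c, 1 ≤ m ∧ m < p.m₀ ∧ E.Prevails ω m c := by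
        by_contra hcon
        push Not at hcon
        exact hωN fun i' hi' c => hcon (i' + 1) c (by omega) (by omega)
      obtain ⟨m, c, hm1, hm2, hc⟩ := hstart
      have hpre : ∀ m', m + 1 ≤ m' → m' ≤ p.m₀ → E.Preconsensus ω m' c := by
        intro m' hm'
        induction m', hm' using Nat.le_induction with
        | base => exact fun _ => E.preconsensus_succ_of_lt hm2 h_ℓ hc
        | succ m' hm' ih =>
          intro h
          refine E.preconsensus_succ_of_lt (by omega) h_ℓ ?_
          by_contra hcon
          exact hrel m' (by omega) (by omega) ⟨c, ih (by omega), hcon⟩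
      have hfin := E.final_of_consolidated hh h_m₀ h_ℓ h_β (hpre p.m₀ hm2 le_rfl) hrel
        fun j => not_not.1 (hωF j)
      refine hωH ⟨?_, ?_⟩
      · cases c
        · exact Or.inl fun j => ⟨_, (hfin j).1, (hfin j).2⟩
        · exact Or.inr fun j => ⟨_, (hfin j).1, (hfin j).2⟩
      · exact sInf_le (Set.mem_image_of_mem (fun m : ℕ => (m : ℕ∞))
          (show p.m₀ + T ∈ {m | ∀ j, E.IsFinal ω m j} from fun j => (hfin j).1))
    have h1 := measureReal_mono (μ := P) hcover
    rw [probReal_univ] at h1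
    have h2 := h1.trans (measureReal_union_le (μ := P) _ _)
    have h3 := measureReal_union_le (μ := P) (E.neverPrevails (p.m₀ - 1)) (R ∪ ⋃ j, fail j)
    have h4 := measureReal_union_le (μ := P) R (⋃ j, fail j)
    linarith

end Execution

/-! ### The three kinds of adversary -/

/-- The length of the interval of unfavourable thresholds against a semi-cautious adversary, if
`x n` honest and `α n` adversarial nodes have the opinion `1`. -/
theorem semiCautious_interval_le {q β r x α : ℝ} (hq : q < 1) (hαq : α ≤ q) (hα : 0 ≤ α)
    (hr : 0 ≤ r) :
    min ((x + α) / (1 - q + α) + r / 2) (1 - β) - max (x / (1 - α) - r / 2) β ≤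
      1 / (2 - q) - β + r := by
  have h1 : 0 < 2 - q := by linarith
  have h2 : 0 < 1 - α := by linarith
  have h3 : 0 < 1 - q + α := by linarith
  -- At equality the upper proportion is exactly `1 / (2 - q)`. Below it, the upper end is
  -- controlled and the lower one is cut off at `β`; above it, the roles are exchanged.
  rcases le_or_gt (x / (1 - α)) (1 - 1 / (2 - q)) with h | h
  · have hU : (x + α) / (1 - q + α) ≤ 1 / (2 - q) := by
      rw [div_le_iff₀ h2, one_sub_div h1.ne', div_mul_eq_mul_div, le_div_iff₀ h1] at h
      rw [div_le_div_iff₀ h3 h1]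
      linarith
    have := min_le_left ((x + α) / (1 - q + α) + r / 2) (1 - β)
    have := le_max_right (x / (1 - α) - r / 2) β
    linarith
  · have := min_le_right ((x + α) / (1 - q + α) + r / 2) (1 - β)
    have := le_max_left (x / (1 - α) - r / 2) β
    linarith

theorem card_filter_beq {ι : Type*} [Fintype ι] (ξ : ι → Bool) :
    (Finset.univ.filter fun j => ξ j = false).card + (Finset.univ.filter fun j => ξ j = true).card =
      Fintype.card ι := by
  classical
  have := Finset.card_filter_add_card_filter_not (s := Finset.univ) fun j => ξ j = false
  simpa using this

namespace Execution

variable {p : Params} {θ : ℝ} {Ω : Type*} [mΩ : MeasurableSpace Ω] {P : Measure Ω}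
  (E : Execution p θ P)

theorem fringe_nonneg : 0 ≤ p.fringe := Real.sqrt_nonneg _

theorem tail_nonneg : 0 ≤ p.tail := mul_nonneg zero_le_two (Real.exp_pos _).le

section Adversaries

variable [IsProbabilityMeasure P] (hh : 1 ≤ p.honest) (h_m₀ : 1 ≤ p.m₀) (h_ℓ : 1 ≤ p.ℓ)
    (h_qβ : p.q < p.β) (h_β : p.β < 1 / 2) (h_φ : 0 < p.φ) (h_θ : 0 < θ) (h_θ' : θ < 1) (u : ℕ)

include hh h_m₀ h_ℓ h_qβ h_β h_φ h_θ h_θ'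

/-- Consensus is likely if the least favourable samples for the two opinions differ little. -/
theorem consensus_of_constrained (a : Bool → Option Bool)
    {bit : ℕ → Ω → Fin p.adversarial → Bool}
    (hbit : ∀ m v, MeasurableSet[E.pre (m + 1)] {ω | bit (m + 1) ω v = true})
    (hcon : ∀ m, E.Constrained m a (bit (m + 1))) {D : ℝ} (hD : 0 ≤ D)
    (hfrac : ∀ (ξ : Fin p.honest → Bool) (b : Fin p.adversarial → Bool), ∃ x : Bool → ℝ,
      (∀ c, ((Finset.univ.filter fun v => sampler (p := p) a c ξ b v = some true).card : ℝ) =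
        x c * (Finset.univ.filter fun v => sampler (p := p) a c ξ b v ≠ none).card) ∧
      min (1 - x false + p.fringe / 2) (1 - p.β) - max (x true - p.fringe / 2) p.β ≤
        D * (1 - 2 * p.β)) :
    1 - p.W u - (1 - θ + θ * (p.tail + D)) ^ (p.m₀ - 1) ≤
      P.real ((E.allFinal false ∪ E.allFinal true) ∩
        {ω | E.numRounds ω ≤ ((p.m₀ + p.ℓ * u : ℕ) : ℕ∞)}) :=
  E.consensus_of_prevails hh h_m₀ h_ℓ h_qβ h_β h_φ h_θ h_θ' (add_nonneg tail_nonneg hD)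
    (fun m hm A hA => E.measure_no_prevails_le hh h_qβ h_β h_φ hm (E.past_le_pre m A hA)
      (hbit m) (hcon m) hD hfrac) u

/-- All nodes answer as fixed in advance, so the proportions for the two opinions add up to 1 and
only the fringe remains. -/
theorem consensus_cautious (hE : E.IsCautious) :
    1 - p.W u - (1 - θ + θ * p.ψCau) ^ (p.m₀ - 1) ≤
      P.real ((E.allFinal false ∪ E.allFinal true) ∩
        {ω | E.numRounds ω ≤ ((p.m₀ + p.ℓ * u : ℕ) : ℕ∞)}) := by
  obtain ⟨bit, hbit, hrep⟩ := hE
  have hn := Params.n_pos hh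
  have hb : 0 < 1 - 2 * p.β := by linarith
  refine E.consensus_of_constrained hh h_m₀ h_ℓ h_qβ h_β h_φ h_θ h_θ' u some hbit ?_
    (mul_nonneg (inv_nonneg.2 hb.le) fringe_nonneg) fun ξ b => ?_
  · intro m ω v j i c
    rw [hrep m ω v j i]
    cases bit (m + 1) ω v <;> cases c <;> simp
  · have hξ := card_filter_beq ξ
    have hb' := card_filter_beq b
    rw [Fintype.card_fin] at hξ hb'
    have hN : p.n = p.honest + p.adversarial := rfl
    refine ⟨fun c => (((Finset.univ.filter fun j => ξ j = c).card +
      (Finset.univ.filter fun v => b v = c).card : ℕ) : ℝ) / p.n, fun c => ?_, ?_⟩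
    · rw [card_filter_sampler some c ξ b (fun r => r = some true),
        card_filter_sampler some c ξ b (fun r => r ≠ none)]
      simp only [Option.some.injEq, beq_iff_eq, ne_eq, reduceCtorEq, not_false_eq_true,
        Finset.filter_true, Finset.card_univ, Fintype.card_fin]
      rw [← hN, div_mul_cancel₀ _ hn.ne']
    · rw [mul_right_comm, inv_mul_cancel₀ hb.ne', one_mul]
      refine (sub_le_sub (min_le_left _ _) (le_max_left _ _)).trans (le_of_eq ?_)
      have : (p.n : ℝ) - ((Finset.univ.filter fun j => ξ j = false).card +
          (Finset.univ.filter fun v => b v = false).card : ℕ) =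
          ((Finset.univ.filter fun j => ξ j = true).card +
          (Finset.univ.filter fun v => b v = true).card : ℕ) := by
        rw [sub_eq_iff_eq_add]
        exact_mod_cast (by omega : p.n = _ + _)
      rw [one_sub_div hn.ne', this]
      ring

/-- All adversarial nodes count against either opinion, so the proportions add up to `1 - q` and the
interval grows by `q`. -/
theorem consensus_berserk :
    1 - p.W u - (1 - θ + θ * p.ψBer) ^ (p.m₀ - 1) ≤
      P.real ((E.allFinal false ∪ E.allFinal true) ∩
        {ω | E.numRounds ω ≤ ((p.m₀ + p.ℓ * u : ℕ) : ℕ∞)}) := by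
  have hn := Params.n_pos hh
  have hb : 0 < 1 - 2 * p.β := by linarith
  refine E.consensus_of_constrained hh h_m₀ h_ℓ h_qβ h_β h_φ h_θ h_θ' u (fun _ => some false)
    (bit := fun _ _ _ => true) (fun m v => MeasurableSet.const _)
    (fun m => E.constrained_arbitrary m _)
    (div_nonneg (add_nonneg Params.q_nonneg fringe_nonneg) hb.le) fun ξ b => ?_
  have hξ := card_filter_beq ξ
  rw [Fintype.card_fin] at hξ
  have hN : p.n = p.honest + p.adversarial := rfl
  refine ⟨fun c => ((Finset.univ.filter fun j => ξ j = c).card : ℝ) / p.n, fun c => ?_, ?_⟩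
  · rw [card_filter_sampler _ c ξ b (fun r => r = some true),
      card_filter_sampler _ c ξ b (fun r => r ≠ none)]
    simp only [Option.some.injEq, beq_iff_eq, ne_eq, reduceCtorEq, not_false_eq_true,
      Finset.filter_true, Finset.card_univ, Fintype.card_fin, Bool.false_eq_true,
      Finset.filter_false, Finset.card_empty, add_zero]
    rw [← hN, div_mul_cancel₀ _ hn.ne']
  · rw [div_mul_cancel₀ _ hb.ne']
    refine (sub_le_sub (min_le_left _ _) (le_max_left _ _)).trans (le_of_eq ?_)
    have hq : p.q = p.adversarial / p.n := rfl
    rw [hq, one_sub_div hn.ne']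
    have hN' : (p.n : ℝ) = (Finset.univ.filter fun j => ξ j = false).card +
        (Finset.univ.filter fun j => ξ j = true).card + p.adversarial := by
      exact_mod_cast hξ ▸ hN
    have : (p.n : ℝ) - (Finset.univ.filter fun j => ξ j = false).card =
        (Finset.univ.filter fun j => ξ j = true).card + p.adversarial := by linarith
    rw [this]
    ring

/-- The sample is worst for an opinion if the adversarial nodes preferring it are silent and the
others answer. They then drop out of the denominator, so the two proportions have different
denominators. -/
theorem consensus_semiCautious (hE : E.IsSemiCautious) :
    1 - p.W u - (1 - θ + θ * p.ψSemi) ^ (p.m₀ - 1) ≤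
      P.real ((E.allFinal false ∪ E.allFinal true) ∩
        {ω | E.numRounds ω ≤ ((p.m₀ + p.ℓ * u : ℕ) : ℕ∞)}) := by
  obtain ⟨bit, hbit, hrep⟩ := hE
  have hn := Params.n_pos hh
  have hb : 0 < 1 - 2 * p.β := by linarith
  have hq0 := Params.q_nonneg (p := p)
  have hq1 := Params.one_sub_q_pos hh
  have hD : 0 ≤ 1 / (2 - p.q) - p.β + p.fringe := by
    have : 1 / 2 ≤ 1 / (2 - p.q) := one_div_le_one_div_of_le (by linarith) (by linarith)
    have := fringe_nonneg (p := p)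
    linarith
  refine E.consensus_of_constrained hh h_m₀ h_ℓ h_qβ h_β h_φ h_θ h_θ' u
    (fun v => if v then none else some false) hbit ?_ (div_nonneg hD hb.le) fun ξ b => ?_
  · intro m ω v j i c
    rcases hrep m ω v j i with h | h <;> rw [h] <;> cases bit (m + 1) ω v <;> cases c <;> simp
  · have hξ := card_filter_beq ξ
    have hb' := card_filter_beq b
    rw [Fintype.card_fin] at hξ hb'
    set h₁ := (Finset.univ.filter fun j => ξ j = true).card with hh₁
    set h₀ := (Finset.univ.filter fun j => ξ j = false).card with hh₀
    set a₁ := (Finset.univ.filter fun v => b v = true).card with ha₁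
    set a₀ := (Finset.univ.filter fun v => b v = false).card with ha₀
    have hh' : (0 : ℝ) < p.honest := by exact_mod_cast hh
    have hpos : ∀ a : ℕ, (0 : ℝ) < p.honest + a := fun a => by positivity
    refine ⟨fun c => if c then (h₁ : ℝ) / (p.honest + a₀) else (h₀ : ℝ) / (p.honest + a₁),
      fun c => ?_, ?_⟩
    · rw [card_filter_sampler _ c ξ b (fun r => r = some true),
        card_filter_sampler _ c ξ b (fun r => r ≠ none)]
      have e1 : (Finset.univ.filter fun v =>
          (if (b v == c) = true then none else some false) = some true).card = 0 := by
        rw [Finset.card_eq_zero, Finset.filter_eq_empty_iff]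
        intro v _
        split_ifs <;> simp
      have e2 : (Finset.univ.filter fun v =>
          (if (b v == c) = true then none else some false) ≠ none) =
          Finset.univ.filter fun v => b v = !c := by
        ext v
        cases hv : b v <;> cases c <;> simp [hv]
      rw [e1, e2]
      simp only [Option.some.injEq, beq_iff_eq, ne_eq, reduceCtorEq, not_false_eq_true,
        Finset.filter_true, Finset.card_univ, Fintype.card_fin, add_zero]
      cases c
      · simp only [Bool.false_eq_true, if_false, Bool.not_false]
        push_cast
        rw [div_mul_cancel₀ _ (hpos _).ne']
      · simp only [if_true, Bool.not_true]
        push_cast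
        rw [div_mul_cancel₀ _ (hpos _).ne']
    · rw [div_mul_cancel₀ _ hb.ne']
      have hN : (p.n : ℝ) = p.honest + p.adversarial := by unfold Params.n; push_cast; rfl
      have hξ' : (h₀ : ℝ) + h₁ = p.honest := by exact_mod_cast hξ
      have hb'' : (a₀ : ℝ) + a₁ = p.adversarial := by exact_mod_cast hb'
      have hqn := Params.q_mul_n hh
      have hαq : (a₁ : ℝ) / p.n ≤ p.q := by
        rw [div_le_iff₀ hn, hqn, ← hb'']
        have : (0 : ℝ) ≤ a₀ := Nat.cast_nonneg _
        linarith
      have key := semiCautious_interval_le (β := p.β) (x := (h₁ : ℝ) / p.n) (by linarith) hαq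
        (div_nonneg (Nat.cast_nonneg _) hn.le) (fringe_nonneg (p := p))
      have e3 : (h₁ : ℝ) / p.n / (1 - a₁ / p.n) = h₁ / (p.honest + a₀) := by
        rw [one_sub_div hn.ne', div_div_div_cancel_right₀ hn.ne']
        congr 1
        linarith
      have e4 : ((h₁ : ℝ) / p.n + a₁ / p.n) / (1 - p.q + a₁ / p.n) =
          1 - h₀ / (p.honest + a₁) := by
        have : p.q = p.adversarial / p.n := rfl
        rw [one_sub_div (hpos _).ne', this, one_sub_div hn.ne', ← add_div, ← add_div,
          div_div_div_cancel_right₀ hn.ne']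
        congr 1 <;> linarith
      rw [e3, e4] at key
      simpa using key

end Adversaries

end Execution

end FPC

end

theorem mainTheorem7 (p : FPC.Params) (θ : ℝ) (u : ℕ)
    (h_honest : 1 ≤ p.honest) (h_m₀ : 1 ≤ p.m₀) (h_ℓ : 1 ≤ p.ℓ)
    (h_a : 1 / 2 < p.a) (h_ab : p.a ≤ p.b) (h_b : p.b < 1)
    (h_qβ : p.q < p.β) (h_β : p.β < 1 / 2) (h_φ : 0 < p.φ)
    (h_θ : 0 < θ) (h_θ' : θ < 1)
    {Ω : Type*} [MeasurableSpace Ω] (P : Measure Ω) [IsProbabilityMeasure P]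
    (E : FPC.Execution p θ P) :
    (E.IsCautious →
      1 - p.W u - (1 - θ + θ * p.ψCau) ^ (p.m₀ - 1) ≤
        P.real ((E.allFinal false ∪ E.allFinal true) ∩
          {ω | E.numRounds ω ≤ ((p.m₀ + p.ℓ * u : ℕ) : ℕ∞)})) ∧
    -- an arbitrary execution is one against a berserk adversary
    (1 - p.W u - (1 - θ + θ * p.ψBer) ^ (p.m₀ - 1) ≤
        P.real ((E.allFinal false ∪ E.allFinal true) ∩
          {ω | E.numRounds ω ≤ ((p.m₀ + p.ℓ * u : ℕ) : ℕ∞)})) ∧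
    (E.IsSemiCautious → 1 / (2 - p.q) - p.β + p.fringe < 1 - 2 * p.β →
      1 - p.W u - (1 - θ + θ * p.ψSemi) ^ (p.m₀ - 1) ≤
        P.real ((E.allFinal false ∪ E.allFinal true) ∩
          {ω | E.numRounds ω ≤ ((p.m₀ + p.ℓ * u : ℕ) : ℕ∞)})) :=
  ⟨E.consensus_cautious h_honest h_m₀ h_ℓ h_qβ h_β h_φ h_θ h_θ' u,
    E.consensus_berserk h_honest h_m₀ h_ℓ h_qβ h_β h_φ h_θ h_θ' u,
    fun hE _ => E.consensus_semiCautious h_honest h_m₀ h_ℓ h_qβ h_β h_φ h_θ h_θ' u hE⟩
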